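/- For a differentiable family $\rho(\alpha)$ of density matrices, let $L_\alpha$ be a symmetric logarithmic derivative, i.e. a Hermitian matrix with $\tfrac12(L_\alpha\rho(\alpha)+\rho(\alpha)L_\alpha)=\partial_\alpha\rho(\alpha)$, and let $J(\alpha)=\mathrm{Tr}[\rho(\alpha)L_\alpha^2]$ be the quantum Fisher information (it does not depend on the choice of $L_\alpha$). Let $\sigma=(\sigma_1,\sigma_2,\sigma_3)$ be the Pauli matrices, $\hat m,\hat n\in\mathbb R^3$ unit vectors, $t_1,t_2\in\mathbb R$, $G_1=\hat m\cdot\sigma+t_1I$, $G_2=\hat n\cdot\sigma+t_2I$, and $U_\alpha=e^{-i\alpha G_1\otimes G_2}$ on $\mathbb C^2\otimes\mathbb C^2$, $\alpha\in\mathbb R$. For a pure probe, i.e. a unit vector $\psi\in\mathbb C^2\otimes\mathbb C^2$, consider the joint output state $\rho_{BF}(\alpha)=U_\alpha|\psi\rangle\langle\psi|U_\alpha^\dagger$, where $B$ and $F$ are the first and the second tensor factor, and the output state $\rho_B(\alpha)=\mathrm{Tr}_F\,\rho_{BF}(\alpha)$ of $B$ alone. Let $\overline J_{BF}$ and $\overline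 J_B$ be the maxima over all pure probes of the quantum Fisher information of $\rho_{BF}(\alpha)$ and of $\rho_B(\alpha)$. These quantities are well defined: symmetric logarithmic derivatives exist for every pure probe and every $\alpha$, and both maxima are attained, each of them by a pure probe that is optimal for all $\alpha$ simultaneously. Moreover, for every $\alpha$, $$\overline J_B=\overline J_{BF}\iff |t_1|\le\min(1,|t_2|),$$ and the gap is $$\overline J_{BF}-\overline J_B=\begin{cases}0,&|t_1|\le|t_2|,\ |t_1|\le1,\\ 4(|t_1|-|t_2|)(2+|t_1|+|t_2|),&|t_2|\le|t_1|,\ |t_2|\le1,\\ 4(t_1-1)(t_1+2|t_2|+1),&t_1>1,\ |t_2|>1,\\ 4(t_1+1)(t_1-2|t_2|-1),&t_1<-1,\ |t_2|>1.\end{cases}$$ -/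

import Mathlib

open scoped Kronecker

namespace Bottleneck

/-- The Pauli matrices `σ₁, σ₂, σ₃`. -/
def pauli : Fin 3 → Matrix (Fin 2) (Fin 2) ℂ :=
  ![!![0, 1; 1, 0], !![0, -Complex.I; Complex.I, 0], !![1, 0; 0, -1]]

/-- The single-qubit generator `v · σ + t I`. -/
noncomputable def qubitGenerator (v : EuclideanSpace ℝ (Fin 3)) (t : ℝ) :
    Matrix (Fin 2) (Fin 2) ℂ :=
  (∑ k, (v k : ℂ) • pauli k) + (t : ℂ) • (1 : Matrix (Fin 2) (Fin 2) ℂ)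

/-- The unitary `U_α = exp (-i α G₁ ⊗ G₂)`. The first tensor factor is the system called `A` at the
input and `B` at the output, the second one is `E` at the input and `F` at the output. -/
noncomputable def evolution (G₁ G₂ : Matrix (Fin 2) (Fin 2) ℂ) (α : ℝ) :
    Matrix (Fin 2 × Fin 2) (Fin 2 × Fin 2) ℂ :=
  NormedSpace.exp ((-(Complex.I * (α : ℂ))) • (G₁ ⊗ₖ G₂))

/-- The pure probes on `AE`: the unit vectors of `ℂ² ⊗ ℂ²`. -/
def pureProbes : Set (EuclideanSpace ℂ (Fin 2 × Fin 2)) :=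
  {ψ | ‖ψ‖ = 1}

/-- The rank one matrix `|ψ⟩⟨ψ|`. -/
def ketBra (ψ : EuclideanSpace ℂ (Fin 2 × Fin 2)) :
    Matrix (Fin 2 × Fin 2) (Fin 2 × Fin 2) ℂ :=
  Matrix.of fun x y => ψ x * star (ψ y)

/-- The joint output state `U_α |ψ⟩⟨ψ| U_α†` of `BF`. -/
noncomputable def outputBF (G₁ G₂ : Matrix (Fin 2) (Fin 2) ℂ)
    (ψ : EuclideanSpace ℂ (Fin 2 × Fin 2)) (α : ℝ) :
    Matrix (Fin 2 × Fin 2) (Fin 2 × Fin 2) ℂ :=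
  evolution G₁ G₂ α * ketBra ψ * (evolution G₁ G₂ α).conjTranspose

/-- The partial trace over the second tensor factor. -/
def partialTraceRight (M : Matrix (Fin 2 × Fin 2) (Fin 2 × Fin 2) ℂ) :
    Matrix (Fin 2) (Fin 2) ℂ :=
  Matrix.of fun i j => ∑ k, M (i, k) (j, k)

/-- The output state of `B` alone. -/
noncomputable def outputB (G₁ G₂ : Matrix (Fin 2) (Fin 2) ℂ)
    (ψ : EuclideanSpace ℂ (Fin 2 × Fin 2)) (α : ℝ) : Matrix (Fin 2) (Fin 2) ℂ :=
  partialTraceRight (outputBF G₁ G₂ ψ α)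

section QFI

variable {n : Type*} [Fintype n]

/-- `L` is a symmetric logarithmic derivative of the family `ρ` at `α`: it is Hermitian, `ρ` is
differentiable at `α` (entry by entry), and `(L ρ + ρ L) / 2 = dρ/dα` there. -/
def IsSLD (ρ : ℝ → Matrix n n ℂ) (α : ℝ) (L : Matrix n n ℂ) : Prop :=
  L.IsHermitian ∧
    ∀ i j, HasDerivAt (fun a => ρ a i j) ((1 / 2 : ℂ) * (L * ρ α + ρ α * L) i j) α

open Classical in
/-- The quantum Fisher information `Tr (ρ L²)` of the family `ρ` at `α`, where `L` is a symmetric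
logarithmic derivative (the value does not depend on which one, see `IsSLD.qfi_eq`). The default
value `0` is for families that have no symmetric logarithmic derivative at `α`. -/
noncomputable def qfi (ρ : ℝ → Matrix n n ℂ) (α : ℝ) : ℝ :=
  if h : ∃ L, IsSLD ρ α L then (Matrix.trace (ρ α * (h.choose * h.choose))).re else 0

theorem IsSLD.trace_eq {ρ : ℝ → Matrix n n ℂ} {α : ℝ} {L M : Matrix n n ℂ}
    (hL : IsSLD ρ α L) (hM : IsSLD ρ α M) :
    Matrix.trace (ρ α * (L * L)) = Matrix.trace (ρ α * (M * M)) := by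
  have h : L * ρ α + ρ α * L = M * ρ α + ρ α * M := by
    ext i j
    have := (hL.2 i j).unique (hM.2 i j)
    simpa using this
  have key : ∀ X Y : Matrix n n ℂ, Matrix.trace ((X * ρ α + ρ α * X) * Y)
      = Matrix.trace ((Y * ρ α + ρ α * Y) * X) := by
    intro X Y
    simp only [add_mul, Matrix.trace_add]
    rw [Matrix.mul_assoc X, Matrix.trace_mul_comm X, Matrix.mul_assoc Y,
      Matrix.trace_mul_comm Y, add_comm]
  have two : ∀ X : Matrix n n ℂ, Matrix.trace ((X * ρ α + ρ α * X) * X)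
      = 2 * Matrix.trace (ρ α * (X * X)) := by
    intro X
    simp only [add_mul, Matrix.trace_add]
    rw [Matrix.mul_assoc X, Matrix.trace_mul_comm X, Matrix.mul_assoc]
    ring
  have e : Matrix.trace ((L * ρ α + ρ α * L) * L) = Matrix.trace ((M * ρ α + ρ α * M) * M) := by
    rw [h, key M L, h]
  rw [two, two] at e
  exact mul_left_cancel₀ two_ne_zero e

theorem IsSLD.qfi_eq {ρ : ℝ → Matrix n n ℂ} {α : ℝ} {L : Matrix n n ℂ} (hL : IsSLD ρ α L) :
    qfi ρ α = (Matrix.trace (ρ α * (L * L))).re := by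
  have h : ∃ L, IsSLD ρ α L := ⟨L, hL⟩
  rw [qfi, dif_pos h, IsSLD.trace_eq h.choose_spec hL]

end QFI

/-- The maximal quantum Fisher information over pure probes when only `B` is measured. -/
noncomputable def maxQFIB (G₁ G₂ : Matrix (Fin 2) (Fin 2) ℂ) (α : ℝ) : ℝ :=
  sSup ((fun ψ => qfi (outputB G₁ G₂ ψ) α) '' pureProbes)

/-- The maximal quantum Fisher information over pure probes when `B` and `F` are measured. -/
noncomputable def maxQFIBF (G₁ G₂ : Matrix (Fin 2) (Fin 2) ℂ) (α : ℝ) : ℝ :=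
  sSup ((fun ψ => qfi (outputBF G₁ G₂ ψ) α) '' pureProbes)

end Bottleneck

/-!
The joint generator is `G = (H + t₁) (K + t₂)`, where `H = (m · σ) ⊗ 1` and `K = 1 ⊗ (n · σ)` are
commuting Hermitian involutions. With `w = U_α ψ`, the joint output is `|w⟩⟨w|` with derivative
`-i [G, |w⟩⟨w|]`, and every observable that commutes with `G` is conserved.

For the joint output, the Fisher information of a pure state is four times the variance of `G`
(`isSLD_and_qfi_of_pure`). It is at most the squared spread of the eigenvalues `(t₁ ± 1) (t₂ ± 1)`,
and equal to it for an equal superposition of two extremal eigenvectors. This gives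
`4 * halfSpread t₁ t₂ ^ 2`.

For the first output alone, let `L` be a symmetric logarithmic derivative and `X = L ⊗ 1`. The Fisher
information is `J = ⟨X²⟩ = -i ⟨[X, G]⟩`, and `G` may be replaced here by `T = G - C` for any
Hermitian `C` commuting with `X`. Expanding `0 ≤ ⟨(X + 2 i T)† (X + 2 i T)⟩` gives `J ≤ 4 ⟨T²⟩`
(`expect_sq_le`). With `C = t₁ (1 ⊗ G₂)` one has `T = H (K + t₂)`, so `J ≤ 4 (1 + |t₂|)²`. A product
probe, with an eigenvector of `K` for the sign of `t₂` and mean zero of `H`, has a pure reduced state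
generated by `(t₂ ± 1) G₁` and attains this (`qfi_outputB_eq`). The gap is the difference of the two
maxima.

A symmetric logarithmic derivative of the reduced state exists by an explicit `2 × 2` formula
(`lyapunov_fin_two`) with denominator `det ρ`. Where `det ρ` vanishes, so does the numerator, since
`det ρ` is the squared modulus of the determinant of the coefficient matrix of `w`
(`trace_mul_eq_zero_of_det_eq_zero`).
-/

open scoped Kronecker

namespace Bottleneck

open Matrix

/-! ### Expectation values -/

section Expectation

variable {n : Type*} [Fintype n]

/-- The expectation value `⟨w, X w⟩` of `X` in the state vector `w`, as a linear functional of `X`,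
written as `Tr (|w⟩⟨w| X)`. -/
noncomputable def expect (w : n → ℂ) : Matrix n n ℂ →ₗ[ℂ] ℂ :=
  (Matrix.traceLinearMap n ℂ ℂ).comp (LinearMap.mulLeft ℂ (vecMulVec w (star w)))

theorem expect_apply (w : n → ℂ) (X : Matrix n n ℂ) :
    expect w X = Matrix.trace (vecMulVec w (star w) * X) := rfl

theorem expect_eq_dotProduct (w : n → ℂ) (X : Matrix n n ℂ) :
    expect w X = star w ⬝ᵥ X *ᵥ w := by
  rw [expect_apply, vecMulVec_mul, trace_vecMulVec, dotProduct_comm, dotProduct_mulVec]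

theorem expect_one [DecidableEq n] (w : n → ℂ) : expect w 1 = star w ⬝ᵥ w := by
  rw [expect_eq_dotProduct, one_mulVec]

theorem expect_conjTranspose_mul_self_nonneg (w : n → ℂ) (X : Matrix n n ℂ) :
    0 ≤ (expect w (Xᴴ * X)).re := by
  have h : expect w (Xᴴ * X) = star (X *ᵥ w) ⬝ᵥ (X *ᵥ w) := by
    rw [expect_eq_dotProduct, ← mulVec_mulVec, dotProduct_mulVec, star_mulVec]
  rw [h]
  rw [dotProduct, Complex.re_sum]
  refine Finset.sum_nonneg fun i _ => ?_
  rw [Pi.star_apply, Complex.star_def, ← Complex.normSq_eq_conj_mul_self, Complex.ofReal_re]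
  exact Complex.normSq_nonneg _

/-- If `X` behaves in the state `w` as a symmetric logarithmic derivative for the generator `G`,
then its second moment, which is then the Fisher information, is at most `4 ⟨(G - C)²⟩` for each
Hermitian `C` that commutes with `X`. -/
theorem expect_sq_le (w : n → ℂ) {X G C : Matrix n n ℂ} (hX : X.IsHermitian)
    (hG : G.IsHermitian) (hC : C.IsHermitian) (hXC : X * C = C * X)
    (h : expect w (X * X) = -Complex.I * expect w (X * G - G * X)) :
    (expect w (X * X)).re ≤ 4 * (expect w ((G - C) * (G - C))).re := by
  -- expand the nonnegative second moment of `X + 2i (G - C)`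
  have key := expect_conjTranspose_mul_self_nonneg w (X + (2 * Complex.I) • (G - C))
  have e : (X + (2 * Complex.I) • (G - C))ᴴ * (X + (2 * Complex.I) • (G - C))
      = X * X + (2 * Complex.I) • (X * G - G * X) + (4 : ℂ) • ((G - C) * (G - C)) := by
    have hT : (G - C)ᴴ = G - C := (hG.sub hC)
    have hc : X * G - G * X = X * (G - C) - (G - C) * X := by
      rw [mul_sub, sub_mul, hXC]; abel
    rw [conjTranspose_add, conjTranspose_smul, hT, hX.eq, hc]
    generalize G - C = T
    simp only [star_mul', Complex.star_def, Complex.conj_I, map_ofNat, add_mul, mul_add,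
      smul_mul_assoc, mul_smul_comm]
    match_scalars <;> first | ring1 | linear_combination (-4) * Complex.I_mul_I
  rw [e, map_add, map_add, map_smul, map_smul] at key
  have h2 : (2 * Complex.I) • expect w (X * G - G * X) = -2 * expect w (X * X) := by
    rw [h, smul_eq_mul]; ring
  rw [h2] at key
  have h4 : ((4 : ℂ) • expect w ((G - C) * (G - C))).re
      = 4 * (expect w ((G - C) * (G - C))).re := by simp
  have h3 : (-2 * expect w (X * X)).re = -2 * (expect w (X * X)).re := by simp
  rw [Complex.add_re, Complex.add_re, h4, h3] at key
  linarith

end Expectation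

section Involutions

variable {n : Type*} [Fintype n] [DecidableEq n]

/-- The joint eigenprojections `(1 + s H) (1 + r K) / 4` of two commuting Hermitian involutions have
nonnegative expectation values. -/
theorem expect_joint_nonneg {w : n → ℂ} (hw : star w ⬝ᵥ w = 1) {H K : Matrix n n ℂ}
    (hH : H.IsHermitian) (hK : K.IsHermitian) (hH2 : H * H = 1) (hK2 : K * K = 1)
    (hHK : H * K = K * H) {s r : ℝ} (hs : s * s = 1) (hr : r * r = 1) :
    0 ≤ 1 + s * (expect w H).re + r * (expect w K).re + s * r * (expect w (H * K)).re := by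
  have key := expect_conjTranspose_mul_self_nonneg w
    ((1 + (s : ℂ) • H) * (1 + (r : ℂ) • K))
  have hs' : (s : ℂ) * s = 1 := by exact_mod_cast hs
  have hr' : (r : ℂ) * r = 1 := by exact_mod_cast hr
  have e1 : ((1 + (s : ℂ) • H) * (1 + (s : ℂ) • H)) = (2 : ℂ) • (1 + (s : ℂ) • H) := by
    simp only [add_mul, mul_add, one_mul, mul_one, smul_mul_assoc, mul_smul_comm, hH2]
    match_scalars <;> first | ring1 | linear_combination hs'
  have e2 : ((1 + (r : ℂ) • K) * (1 + (r : ℂ) • K)) = (2 : ℂ) • (1 + (r : ℂ) • K) := by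
    simp only [add_mul, mul_add, one_mul, mul_one, smul_mul_assoc, mul_smul_comm, hK2]
    match_scalars <;> first | ring1 | linear_combination hr'
  have e3 : (1 + (r : ℂ) • K) * (1 + (s : ℂ) • H) = (1 + (s : ℂ) • H) * (1 + (r : ℂ) • K) := by
    simp only [add_mul, mul_add, one_mul, mul_one, smul_mul_assoc, mul_smul_comm, hHK]
    module
  have e : ((1 + (s : ℂ) • H) * (1 + (r : ℂ) • K))ᴴ * ((1 + (s : ℂ) • H) * (1 + (r : ℂ) • K))
      = (4 : ℂ) • (1 + (s : ℂ) • H + (r : ℂ) • K + ((s : ℂ) * r) • (H * K)) := by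
    rw [conjTranspose_mul, conjTranspose_add, conjTranspose_add, conjTranspose_smul,
      conjTranspose_smul, hH.eq, hK.eq, conjTranspose_one, Complex.star_def,
      Complex.conj_ofReal, Complex.conj_ofReal, e3, mul_assoc, ← mul_assoc _ (1 + (s : ℂ) • H), e3,
      mul_assoc _ (1 + (r : ℂ) • K), e2, ← mul_assoc, e1]
    simp only [add_mul, mul_add, one_mul, mul_one, smul_mul_assoc, mul_smul_comm]
    module
  rw [e] at key
  simp only [map_add, map_smul, expect_one, hw, smul_eq_mul] at key
  simp at key
  linarith

/-- An element `T` of the real algebra spanned by two commuting Hermitian involutions satisfies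
`⟨T²⟩ ≤ R` if the squares of its four joint eigenvalues are at most `R`. -/
theorem expect_sq_le_of_joint_eigenvalues {w : n → ℂ} (hw : star w ⬝ᵥ w = 1)
    {H K : Matrix n n ℂ} (hH : H.IsHermitian) (hK : K.IsHermitian) (hH2 : H * H = 1)
    (hK2 : K * K = 1) (hHK : H * K = K * H) {a b c d R : ℝ}
    (hR : ∀ s r : ℝ, s * s = 1 → r * r = 1 → (a + b * s + c * r + d * (s * r)) ^ 2 ≤ R) :
    (expect w (((a : ℂ) • 1 + (b : ℂ) • H + (c : ℂ) • K + (d : ℂ) • (H * K)) *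
      ((a : ℂ) • 1 + (b : ℂ) • H + (c : ℂ) • K + (d : ℂ) • (H * K)))).re ≤ R := by
  have h1 : H * (H * K) = K := by rw [← mul_assoc, hH2, one_mul]
  have h2 : K * (H * K) = H := by rw [hHK, ← mul_assoc, hK2, one_mul]
  have h3 : H * K * H = K := by rw [hHK, mul_assoc, hH2, mul_one]
  have h4 : H * K * K = H := by rw [mul_assoc, hK2, mul_one]
  have h5 : H * K * (H * K) = 1 := by rw [← mul_assoc, h3, hK2]
  have e : ((a : ℂ) • (1 : Matrix n n ℂ) + (b : ℂ) • H + (c : ℂ) • K + (d : ℂ) • (H * K)) *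
      ((a : ℂ) • 1 + (b : ℂ) • H + (c : ℂ) • K + (d : ℂ) • (H * K))
      = ((a ^ 2 + b ^ 2 + c ^ 2 + d ^ 2 : ℝ) : ℂ) • 1 + ((2 * (a * b + c * d) : ℝ) : ℂ) • H
        + ((2 * (a * c + b * d) : ℝ) : ℂ) • K + ((2 * (a * d + b * c) : ℝ) : ℂ) • (H * K) := by
    simp only [add_mul, mul_add, smul_mul_assoc, mul_smul_comm, one_mul, mul_one, hH2, hK2,
      h1, h2, h3, h4, h5, ← hHK]
    push_cast
    module
  rw [e]
  simp only [map_add, map_smul, expect_one, hw, smul_eq_mul, mul_one]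
  simp only [Complex.add_re, Complex.re_ofReal_mul, Complex.ofReal_re]
  have p1 := expect_joint_nonneg hw hH hK hH2 hK2 hHK (s := 1) (r := 1) (by norm_num) (by norm_num)
  have p2 := expect_joint_nonneg hw hH hK hH2 hK2 hHK (s := 1) (r := -1) (by norm_num) (by norm_num)
  have p3 := expect_joint_nonneg hw hH hK hH2 hK2 hHK (s := -1) (r := 1) (by norm_num) (by norm_num)
  have p4 := expect_joint_nonneg hw hH hK hH2 hK2 hHK (s := -1) (r := -1) (by norm_num)
    (by norm_num)
  have q1 := mul_le_mul_of_nonneg_right (hR 1 1 (by norm_num) (by norm_num)) p1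
  have q2 := mul_le_mul_of_nonneg_right (hR 1 (-1) (by norm_num) (by norm_num)) p2
  have q3 := mul_le_mul_of_nonneg_right (hR (-1) 1 (by norm_num) (by norm_num)) p3
  have q4 := mul_le_mul_of_nonneg_right (hR (-1) (-1) (by norm_num) (by norm_num)) p4
  -- the second moment is the average of the squared eigenvalues with the four joint probabilities
  linarith

end Involutions

/-! ### Pure states -/

section PureStates

variable {n : Type*} [Fintype n]

theorem vecMulVec_mul_mul_vecMulVec (w : n → ℂ) (X : Matrix n n ℂ) :
    vecMulVec w (star w) * X * vecMulVec w (star w)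
      = Matrix.trace (vecMulVec w (star w) * X) • vecMulVec w (star w) := by
  rw [vecMulVec_mul, vecMulVec_mul_vecMulVec, trace_vecMulVec, dotProduct_comm,
    vecMulVec_smul]

/-- The Fisher information of a family that is pure at `α` and generated there by `K` is four times
the variance of `K`; twice the derivative is a symmetric logarithmic derivative. Purity enters as
`ρ X ρ = Tr (ρ X) ρ`. -/
theorem isSLD_and_qfi_of_pure [DecidableEq n] {ρ : ℝ → Matrix n n ℂ} {α : ℝ} {K : Matrix n n ℂ}
    (hρ : (ρ α).IsHermitian) (htr : Matrix.trace (ρ α) = 1)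
    (hpure : ∀ X, ρ α * X * ρ α = Matrix.trace (ρ α * X) • ρ α) (hK : K.IsHermitian)
    (hD : ∀ i j, HasDerivAt (fun a => ρ a i j)
      (((-Complex.I) • (K * ρ α - ρ α * K)) i j) α) :
    IsSLD ρ α ((2 : ℂ) • ((-Complex.I) • (K * ρ α - ρ α * K))) ∧
    qfi ρ α = 4 * (Matrix.trace (ρ α * (K * K)) - Matrix.trace (ρ α * K) ^ 2).re := by
  have h2 : ρ α * ρ α = ρ α := by
    have := hpure 1
    simpa [htr] using this
  have h3 := hpure K
  have hsld : IsSLD ρ α ((2 : ℂ) • ((-Complex.I) • (K * ρ α - ρ α * K))) := by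
    constructor
    · unfold Matrix.IsHermitian
      rw [conjTranspose_smul, conjTranspose_smul, conjTranspose_sub, conjTranspose_mul,
        conjTranspose_mul, hK.eq, hρ.eq]
      simp only [star_neg, Complex.star_def, Complex.conj_I, map_ofNat]
      module
    · intro i j
      convert hD i j using 1
      have : (2 : ℂ) • ((-Complex.I) • (K * ρ α - ρ α * K)) * ρ α
          + ρ α * (2 : ℂ) • ((-Complex.I) • (K * ρ α - ρ α * K))
          = (2 : ℂ) • ((-Complex.I) • (K * ρ α - ρ α * K)) := by
        simp only [smul_mul_assoc, mul_smul_comm, sub_mul, mul_sub]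
        rw [mul_assoc K, h2, ← mul_assoc, ← mul_assoc, h2]
        module
      rw [this]
      simp
  refine ⟨hsld, ?_⟩
  rw [hsld.qfi_eq]
  have h2' (X) : ρ α * (ρ α * X) = ρ α * X := by rw [← mul_assoc, h2]
  have h3' (X) : ρ α * (K * (ρ α * X)) = Matrix.trace (ρ α * K) • (ρ α * X) := by
    rw [← mul_assoc, ← mul_assoc, h3, smul_mul_assoc]
  rw [mul_assoc] at h3
  have e : ρ α * (((2 : ℂ) • ((-Complex.I) • (K * ρ α - ρ α * K))) *
      ((2 : ℂ) • ((-Complex.I) • (K * ρ α - ρ α * K))))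
      = (4 : ℂ) • (ρ α * (K * K) * ρ α - (Matrix.trace (ρ α * K) ^ 2) • ρ α) := by
    generalize hτ : Matrix.trace (ρ α * K) = τ at *
    simp only [smul_mul_assoc, mul_smul_comm, sub_mul, mul_sub, mul_assoc, h2', h3, h3']
    match_scalars
    · linear_combination 4 * τ ^ 2 * Complex.I_mul_I
    · linear_combination (-4) * Complex.I_mul_I
    · ring1
  rw [e, trace_smul, trace_sub, trace_smul, htr, trace_mul_comm, h2']
  simp

end PureStates

/-! ### The evolution of a probe -/

section Evolution

/-- The vector `U_α ψ`, whose ket-bra is the joint output state. -/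
noncomputable def outputVec (G₁ G₂ : Matrix (Fin 2) (Fin 2) ℂ)
    (ψ : EuclideanSpace ℂ (Fin 2 × Fin 2)) (α : ℝ) : Fin 2 × Fin 2 → ℂ :=
  evolution G₁ G₂ α *ᵥ ψ

theorem outputBF_eq_vecMulVec (G₁ G₂ : Matrix (Fin 2) (Fin 2) ℂ)
    (ψ : EuclideanSpace ℂ (Fin 2 × Fin 2)) (α : ℝ) :
    outputBF G₁ G₂ ψ α = vecMulVec (outputVec G₁ G₂ ψ α) (star (outputVec G₁ G₂ ψ α)) := by
  have h : ketBra ψ = vecMulVec ψ (star (ψ : Fin 2 × Fin 2 → ℂ)) := rfl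
  rw [outputBF, h, outputVec, star_mulVec, mul_vecMulVec, vecMulVec_mul]

theorem outputB_apply (G₁ G₂ : Matrix (Fin 2) (Fin 2) ℂ)
    (ψ : EuclideanSpace ℂ (Fin 2 × Fin 2)) (α : ℝ) (i j : Fin 2) :
    outputB G₁ G₂ ψ α i j = ∑ k, outputBF G₁ G₂ ψ α (i, k) (j, k) := rfl

open scoped Matrix.Norms.Operator in
theorem hasDerivAt_evolution (G₁ G₂ : Matrix (Fin 2) (Fin 2) ℂ) (α : ℝ) (x y : Fin 2 × Fin 2) :
    HasDerivAt (fun a => evolution G₁ G₂ a x y)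
      (-Complex.I * ((G₁ ⊗ₖ G₂) * evolution G₁ G₂ α) x y) α := by
  have h := hasDerivAt_exp_smul_const' (𝕂 := ℝ) ((-Complex.I) • (G₁ ⊗ₖ G₂)) α
  have e : ∀ a : ℝ, a • ((-Complex.I) • (G₁ ⊗ₖ G₂)) = (-(Complex.I * (a : ℂ))) • (G₁ ⊗ₖ G₂) := by
    intro a
    rw [← Complex.coe_smul, smul_smul]
    congr 1
    ring
  simp only [e, smul_mul_assoc] at h
  exact (LinearMap.toContinuousLinearMap (Matrix.entryLinearMap ℝ ℂ x y)).hasFDerivAt.comp_hasDerivAt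
    α h

theorem hasDerivAt_outputVec (G₁ G₂ : Matrix (Fin 2) (Fin 2) ℂ)
    (ψ : EuclideanSpace ℂ (Fin 2 × Fin 2)) (α : ℝ) (x : Fin 2 × Fin 2) :
    HasDerivAt (fun a => outputVec G₁ G₂ ψ a x)
      (-Complex.I * ((G₁ ⊗ₖ G₂) *ᵥ outputVec G₁ G₂ ψ α) x) α := by
  have h : HasDerivAt (fun a => ∑ y, evolution G₁ G₂ a x y * ψ y)
      (∑ y, -Complex.I * ((G₁ ⊗ₖ G₂) * evolution G₁ G₂ α) x y * ψ y) α :=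
    HasDerivAt.fun_sum fun y _ => (hasDerivAt_evolution G₁ G₂ α x y).mul_const _
  refine h.congr_deriv ?_
  rw [outputVec, mulVec_mulVec, mulVec, dotProduct, Finset.mul_sum]
  simp only [mul_assoc]

theorem evolution_commute {G₁ G₂ : Matrix (Fin 2) (Fin 2) ℂ}
    {X : Matrix (Fin 2 × Fin 2) (Fin 2 × Fin 2) ℂ} (hX : X * (G₁ ⊗ₖ G₂) = (G₁ ⊗ₖ G₂) * X)
    (α : ℝ) : X * evolution G₁ G₂ α = evolution G₁ G₂ α * X := by
  have : Commute X ((-(Complex.I * (α : ℂ))) • (G₁ ⊗ₖ G₂)) := Commute.smul_right hX _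
  exact this.exp_right

theorem conjTranspose_evolution_mul_self {G₁ G₂ : Matrix (Fin 2) (Fin 2) ℂ}
    (h₁ : G₁.IsHermitian) (h₂ : G₂.IsHermitian) (α : ℝ) :
    (evolution G₁ G₂ α)ᴴ * evolution G₁ G₂ α = 1 := by
  have e : ((-(Complex.I * (α : ℂ))) • (G₁ ⊗ₖ G₂))ᴴ = -((-(Complex.I * (α : ℂ))) • (G₁ ⊗ₖ G₂)) := by
    rw [conjTranspose_smul, conjTranspose_kronecker, h₁.eq, h₂.eq]
    simp
  rw [evolution, ← Matrix.exp_conjTranspose, e, Matrix.exp_neg]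
  exact nonsing_inv_mul _ ((isUnit_iff_isUnit_det _).1 (Matrix.isUnit_exp _))

/-- Observables that commute with the generator are conserved. -/
theorem expect_outputVec {G₁ G₂ : Matrix (Fin 2) (Fin 2) ℂ} (h₁ : G₁.IsHermitian)
    (h₂ : G₂.IsHermitian) {X : Matrix (Fin 2 × Fin 2) (Fin 2 × Fin 2) ℂ}
    (hX : X * (G₁ ⊗ₖ G₂) = (G₁ ⊗ₖ G₂) * X) (ψ : EuclideanSpace ℂ (Fin 2 × Fin 2)) (α : ℝ) :
    expect (outputVec G₁ G₂ ψ α) X = expect (ψ : Fin 2 × Fin 2 → ℂ) X := by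
  rw [expect_eq_dotProduct, expect_eq_dotProduct, outputVec, star_mulVec, mulVec_mulVec,
    ← dotProduct_mulVec, mulVec_mulVec, evolution_commute hX, ← mul_assoc,
    conjTranspose_evolution_mul_self h₁ h₂, one_mul]

theorem mulVec_outputVec {G₁ G₂ : Matrix (Fin 2) (Fin 2) ℂ}
    {X : Matrix (Fin 2 × Fin 2) (Fin 2 × Fin 2) ℂ} (hX : X * (G₁ ⊗ₖ G₂) = (G₁ ⊗ₖ G₂) * X)
    {ψ : EuclideanSpace ℂ (Fin 2 × Fin 2)} {μ : ℂ} (h : X *ᵥ ψ = μ • (ψ : Fin 2 × Fin 2 → ℂ))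
    (α : ℝ) : X *ᵥ outputVec G₁ G₂ ψ α = μ • outputVec G₁ G₂ ψ α := by
  rw [outputVec, mulVec_mulVec, evolution_commute hX, ← mulVec_mulVec, h, mulVec_smul]

theorem mem_pureProbes_iff (ψ : EuclideanSpace ℂ (Fin 2 × Fin 2)) :
    ψ ∈ pureProbes ↔ star (ψ : Fin 2 × Fin 2 → ℂ) ⬝ᵥ (ψ : Fin 2 × Fin 2 → ℂ) = 1 := by
  have h : star (ψ : Fin 2 × Fin 2 → ℂ) ⬝ᵥ (ψ : Fin 2 × Fin 2 → ℂ) = ((‖ψ‖ ^ 2 : ℝ) : ℂ) := by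
    rw [dotProduct_comm, ← EuclideanSpace.inner_eq_star_dotProduct, inner_self_eq_norm_sq_to_K]
    simp
  rw [h, pureProbes, Set.mem_ofPred_eq, ← Complex.ofReal_one, Complex.ofReal_inj,
    pow_eq_one_iff_of_nonneg (norm_nonneg ψ) two_ne_zero]

theorem star_dotProduct_outputVec {G₁ G₂ : Matrix (Fin 2) (Fin 2) ℂ} (h₁ : G₁.IsHermitian)
    (h₂ : G₂.IsHermitian) {ψ : EuclideanSpace ℂ (Fin 2 × Fin 2)} (hψ : ψ ∈ pureProbes) (α : ℝ) :
    star (outputVec G₁ G₂ ψ α) ⬝ᵥ outputVec G₁ G₂ ψ α = 1 := by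
  rw [← expect_one, expect_outputVec h₁ h₂ (by rw [one_mul, mul_one]), expect_one]
  exact (mem_pureProbes_iff ψ).1 hψ

/-- The von Neumann equation `dρ/dα = -i [G, ρ]` for the joint output state. -/
theorem hasDerivAt_outputBF {G₁ G₂ : Matrix (Fin 2) (Fin 2) ℂ} (h₁ : G₁.IsHermitian)
    (h₂ : G₂.IsHermitian) (ψ : EuclideanSpace ℂ (Fin 2 × Fin 2)) (α : ℝ) (x y : Fin 2 × Fin 2) :
    HasDerivAt (fun a => outputBF G₁ G₂ ψ a x y)
      (((-Complex.I) • ((G₁ ⊗ₖ G₂) * outputBF G₁ G₂ ψ α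
        - outputBF G₁ G₂ ψ α * (G₁ ⊗ₖ G₂))) x y) α := by
  have h := (hasDerivAt_outputVec G₁ G₂ ψ α x).mul (hasDerivAt_outputVec G₁ G₂ ψ α y).star
  simp only [outputBF_eq_vecMulVec]
  refine h.congr_deriv ?_
  have hG : (G₁ ⊗ₖ G₂)ᴴ = G₁ ⊗ₖ G₂ := by rw [conjTranspose_kronecker, h₁.eq, h₂.eq]
  have e : star (outputVec G₁ G₂ ψ α) ᵥ* (G₁ ⊗ₖ G₂) = star ((G₁ ⊗ₖ G₂) *ᵥ outputVec G₁ G₂ ψ α) := by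
    rw [star_mulVec, hG]
  rw [mul_vecMulVec, vecMulVec_mul, e]
  simp only [Matrix.smul_apply, Matrix.sub_apply, vecMulVec_apply, Pi.star_apply,
    smul_eq_mul, star_mul', star_neg, Complex.star_def, Complex.conj_I]
  ring

theorem hasDerivAt_outputB {G₁ G₂ : Matrix (Fin 2) (Fin 2) ℂ} (h₁ : G₁.IsHermitian)
    (h₂ : G₂.IsHermitian) (ψ : EuclideanSpace ℂ (Fin 2 × Fin 2)) (α : ℝ) (i j : Fin 2) :
    HasDerivAt (fun a => outputB G₁ G₂ ψ a i j)
      (partialTraceRight ((-Complex.I) • ((G₁ ⊗ₖ G₂) * outputBF G₁ G₂ ψ α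
        - outputBF G₁ G₂ ψ α * (G₁ ⊗ₖ G₂))) i j) α := by
  simp only [outputB_apply, partialTraceRight, of_apply]
  exact HasDerivAt.fun_sum fun k _ => hasDerivAt_outputBF h₁ h₂ ψ α (i, k) (j, k)

end Evolution

/-! ### Partial trace -/

section PartialTrace

theorem trace_partialTraceRight_mul (M : Matrix (Fin 2 × Fin 2) (Fin 2 × Fin 2) ℂ)
    (Y : Matrix (Fin 2) (Fin 2) ℂ) :
    Matrix.trace (partialTraceRight M * Y)
      = Matrix.trace (M * (Y ⊗ₖ (1 : Matrix (Fin 2) (Fin 2) ℂ))) := by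
  simp [Matrix.trace, Matrix.mul_apply, Fintype.sum_prod_type, partialTraceRight,
    kroneckerMap_apply, Matrix.one_apply]
  ring

theorem trace_partialTraceRight (M : Matrix (Fin 2 × Fin 2) (Fin 2 × Fin 2) ℂ) :
    Matrix.trace (partialTraceRight M) = Matrix.trace M := by
  have := trace_partialTraceRight_mul M 1
  rwa [one_kronecker_one, mul_one, mul_one] at this

theorem partialTraceRight_kronecker_mul (A : Matrix (Fin 2) (Fin 2) ℂ)
    (M : Matrix (Fin 2 × Fin 2) (Fin 2 × Fin 2) ℂ) :
    partialTraceRight ((A ⊗ₖ (1 : Matrix (Fin 2) (Fin 2) ℂ)) * M) = A * partialTraceRight M := by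
  ext i j
  simp [Matrix.mul_apply, Fintype.sum_prod_type, partialTraceRight,
    kroneckerMap_apply, Matrix.one_apply]
  ring

theorem partialTraceRight_mul_kronecker (A : Matrix (Fin 2) (Fin 2) ℂ)
    (M : Matrix (Fin 2 × Fin 2) (Fin 2 × Fin 2) ℂ) :
    partialTraceRight (M * (A ⊗ₖ (1 : Matrix (Fin 2) (Fin 2) ℂ))) = partialTraceRight M * A := by
  ext i j
  simp [Matrix.mul_apply, Fintype.sum_prod_type, partialTraceRight,
    kroneckerMap_apply, Matrix.one_apply]
  ring

theorem partialTraceRight_sub (M N : Matrix (Fin 2 × Fin 2) (Fin 2 × Fin 2) ℂ) :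
    partialTraceRight (M - N) = partialTraceRight M - partialTraceRight N := by
  ext i j
  simp [partialTraceRight]

theorem partialTraceRight_smul (c : ℂ) (M : Matrix (Fin 2 × Fin 2) (Fin 2 × Fin 2) ℂ) :
    partialTraceRight (c • M) = c • partialTraceRight M := by
  ext i j
  simp [partialTraceRight, mul_add]

theorem partialTraceRight_conjTranspose (M : Matrix (Fin 2 × Fin 2) (Fin 2 × Fin 2) ℂ) :
    (partialTraceRight M)ᴴ = partialTraceRight Mᴴ := by
  ext i j
  simp [partialTraceRight]

/-- The partial trace of `|w⟩⟨w|` is `M Mᴴ` for the matrix `M` of coefficients of `w`. -/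
theorem partialTraceRight_vecMulVec (w v : Fin 2 × Fin 2 → ℂ) :
    partialTraceRight (vecMulVec w (star v))
      = Matrix.of (Function.curry w) * (Matrix.of (Function.curry v))ᴴ := rfl

end PartialTrace

/-! ### Symmetric logarithmic derivatives of a qubit -/

section Qubit

/-- A `2 × 2` matrix equation `L ρ + ρ L = 2 D` with `Tr ρ = 1` and `Tr D = 0` has an explicit
solution, by the Cayley-Hamilton theorem. If `det ρ = 0` it needs `Tr (D ρ) = 0`, and the quotient
in the formula is then zero. -/
theorem lyapunov_fin_two {ρ D : Matrix (Fin 2) (Fin 2) ℂ} (hρ : Matrix.trace ρ = 1)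
    (hD : Matrix.trace D = 0) (h : ρ.det = 0 → Matrix.trace (D * ρ) = 0) :
    ((2 : ℂ) • D + (Matrix.trace (D * ρ) / ρ.det) • (ρ - 1)) * ρ
      + ρ * ((2 : ℂ) • D + (Matrix.trace (D * ρ) / ρ.det) • (ρ - 1)) = (2 : ℂ) • D := by
  have hq : Matrix.trace (D * ρ) / ρ.det * ρ.det = Matrix.trace (D * ρ) := by
    by_cases h0 : ρ.det = 0
    · rw [h0, mul_zero, h h0]
    · exact div_mul_cancel₀ _ h0
  generalize Matrix.trace (D * ρ) / ρ.det = q at *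
  rw [trace_fin_two] at hρ hD
  rw [det_fin_two, trace_fin_two, mul_apply, mul_apply, Fin.sum_univ_two, Fin.sum_univ_two] at hq
  have h1 : ρ 1 1 = 1 - ρ 0 0 := by linear_combination hρ
  have h2 : D 1 1 = - D 0 0 := by linear_combination hD
  rw [h1, h2] at hq
  ext i j
  fin_cases i <;> fin_cases j <;>
    simp [Matrix.mul_apply, Fin.sum_univ_two, h1, h2]
  · linear_combination (-2) * hq
  · ring1
  · ring1
  · linear_combination (-2) * hq

theorem mul_mul_self_of_det_eq_zero {ρ : Matrix (Fin 2) (Fin 2) ℂ} (h : ρ.det = 0)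
    (X : Matrix (Fin 2) (Fin 2) ℂ) : ρ * X * ρ = Matrix.trace (ρ * X) • ρ := by
  rw [det_fin_two] at h
  ext i j
  fin_cases i <;> fin_cases j <;>
    simp [Matrix.mul_apply, Fin.sum_univ_two, Matrix.trace]
  · linear_combination (-X 1 1) * h
  · linear_combination (X 0 1) * h
  · linear_combination (X 1 0) * h
  · linear_combination (-X 0 0) * h

/-- Jacobi's formula for `ρ = M P` with derivative `N P + M Q`: if `M` and `P` are singular, so
that the determinant has a double zero, then a traceless derivative is orthogonal to `ρ`. -/
theorem trace_mul_eq_zero_of_det_eq_zero {M N P Q : Matrix (Fin 2) (Fin 2) ℂ} (hM : M.det = 0)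
    (hP : P.det = 0) (hD : Matrix.trace (N * P + M * Q) = 0) :
    Matrix.trace ((N * P + M * Q) * (M * P)) = 0 := by
  have e : Matrix.trace ((N * P + M * Q) * (M * P)) =
      Matrix.trace (N * P + M * Q) * Matrix.trace (M * P)
      - P.det * Matrix.trace (M.adjugate * N) - M.det * Matrix.trace (P.adjugate * Q) := by
    simp only [adjugate_fin_two, det_fin_two, trace_fin_two, mul_apply, Matrix.add_apply,
      Fin.sum_univ_two, of_apply, cons_val_zero, cons_val_one]
    ring
  rw [e, hM, hP, hD]
  simp

end Qubit

/-! ### Pauli generators -/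

section Pauli

/-- The traceless generator `v · σ`. -/
noncomputable def pauliVec (v : EuclideanSpace ℝ (Fin 3)) : Matrix (Fin 2) (Fin 2) ℂ :=
  ∑ k, (v k : ℂ) • pauli k

theorem qubitGenerator_eq (v : EuclideanSpace ℝ (Fin 3)) (t : ℝ) :
    qubitGenerator v t = pauliVec v + (t : ℂ) • 1 := rfl

theorem pauliVec_eq (v : EuclideanSpace ℝ (Fin 3)) :
    pauliVec v = !![(v 2 : ℂ), v 0 - Complex.I * v 1; v 0 + Complex.I * v 1, -v 2] := by
  rw [pauliVec, Fin.sum_univ_three]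
  ext i j
  fin_cases i <;> fin_cases j <;> simp [pauli] <;> ring

theorem isHermitian_pauliVec (v : EuclideanSpace ℝ (Fin 3)) : (pauliVec v).IsHermitian := by
  rw [pauliVec_eq]
  ext i j
  fin_cases i <;> fin_cases j <;> simp [Matrix.conjTranspose_apply, sub_eq_add_neg]

theorem trace_pauliVec (v : EuclideanSpace ℝ (Fin 3)) : Matrix.trace (pauliVec v) = 0 := by
  rw [pauliVec_eq, trace_fin_two_of, add_neg_cancel]

theorem pauliVec_mul_self {v : EuclideanSpace ℝ (Fin 3)} (hv : ‖v‖ = 1) :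
    pauliVec v * pauliVec v = 1 := by
  have h : (v 0 : ℂ) ^ 2 + (v 1 : ℂ) ^ 2 + (v 2 : ℂ) ^ 2 = 1 := by
    have := EuclideanSpace.real_norm_sq_eq v
    rw [hv, Fin.sum_univ_three] at this
    have h1 := congrArg Complex.ofReal this
    push_cast at h1
    linear_combination -h1
  rw [pauliVec_eq]
  ext i j
  fin_cases i <;> fin_cases j <;> simp
  · linear_combination h - (v 1 : ℂ) ^ 2 * Complex.I_mul_I
  · ring
  · ring
  · linear_combination h - (v 1 : ℂ) ^ 2 * Complex.I_mul_I

theorem isHermitian_qubitGenerator (v : EuclideanSpace ℝ (Fin 3)) (t : ℝ) :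
    (qubitGenerator v t).IsHermitian := by
  rw [qubitGenerator_eq]
  refine (isHermitian_pauliVec v).add ?_
  rw [Matrix.IsHermitian, conjTranspose_smul, conjTranspose_one]
  simp

theorem exists_pauliVec_eigenvector {v : EuclideanSpace ℝ (Fin 3)} (hv : ‖v‖ = 1) {s : ℝ}
    (hs : s * s = 1) :
    ∃ e : Fin 2 → ℂ, star e ⬝ᵥ e = 1 ∧ pauliVec v *ᵥ e = (s : ℂ) • e := by
  have hs' : (s : ℂ) * s = 1 := by exact_mod_cast hs
  -- a nonzero column of `v · σ + s`, which exists as the trace is not zero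
  obtain ⟨f, hf⟩ : ∃ f : Fin 2 → ℂ, (pauliVec v + (s : ℂ) • 1) *ᵥ f ≠ 0 := by
    by_contra! h
    have h0 : pauliVec v + (s : ℂ) • 1 = 0 := Matrix.ext_of_mulVec_single fun i => by
      rw [h, zero_mulVec]
    have := congrArg Matrix.trace h0
    rw [trace_add, trace_pauliVec, trace_smul, trace_one, trace_zero] at this
    have hs0 : (s : ℂ) = 0 := by simpa using this
    rw [hs0] at hs'
    simp at hs'
  set g := (pauliVec v + (s : ℂ) • 1) *ᵥ f with hg
  have hgs : pauliVec v *ᵥ g = (s : ℂ) • g := by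
    rw [hg, mulVec_mulVec, mul_add, pauliVec_mul_self hv, ← smul_mulVec, smul_add, smul_smul, hs',
      mul_smul_comm, mul_one, one_smul, add_comm]
  have hpos : 0 < ‖WithLp.toLp 2 g‖ := norm_pos_iff.2 fun h => hf (by
    simpa using congrArg WithLp.ofLp h)
  have hgg : star g ⬝ᵥ g = ((‖WithLp.toLp 2 g‖ ^ 2 : ℝ) : ℂ) := by
    have := inner_self_eq_norm_sq_to_K (𝕜 := ℂ) (WithLp.toLp 2 g)
    rw [EuclideanSpace.inner_eq_star_dotProduct, dotProduct_comm] at this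
    simpa using this
  refine ⟨((‖WithLp.toLp 2 g‖⁻¹ : ℝ) : ℂ) • g, ?_, ?_⟩
  · rw [star_smul, smul_dotProduct, dotProduct_smul, hgg, Complex.star_def, Complex.conj_ofReal,
      smul_eq_mul, smul_eq_mul, ← Complex.ofReal_mul, ← Complex.ofReal_mul, Complex.ofReal_eq_one]
    field_simp
  · rw [mulVec_smul, hgs, smul_comm]

end Pauli

/-! ### The generator of the joint evolution -/

section Generator

/-- The involution `v · σ` acting on the first tensor factor. -/
noncomputable def pauliLeft (v : EuclideanSpace ℝ (Fin 3)) :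
    Matrix (Fin 2 × Fin 2) (Fin 2 × Fin 2) ℂ :=
  pauliVec v ⊗ₖ (1 : Matrix (Fin 2) (Fin 2) ℂ)

/-- The involution `v · σ` acting on the second tensor factor. -/
noncomputable def pauliRight (v : EuclideanSpace ℝ (Fin 3)) :
    Matrix (Fin 2 × Fin 2) (Fin 2 × Fin 2) ℂ :=
  (1 : Matrix (Fin 2) (Fin 2) ℂ) ⊗ₖ pauliVec v

theorem isHermitian_pauliLeft (v : EuclideanSpace ℝ (Fin 3)) : (pauliLeft v).IsHermitian := by
  rw [Matrix.IsHermitian, pauliLeft, conjTranspose_kronecker, conjTranspose_one,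
    (isHermitian_pauliVec v).eq]

theorem isHermitian_pauliRight (v : EuclideanSpace ℝ (Fin 3)) : (pauliRight v).IsHermitian := by
  rw [Matrix.IsHermitian, pauliRight, conjTranspose_kronecker, conjTranspose_one,
    (isHermitian_pauliVec v).eq]

theorem pauliLeft_mul_self {v : EuclideanSpace ℝ (Fin 3)} (hv : ‖v‖ = 1) :
    pauliLeft v * pauliLeft v = 1 := by
  rw [pauliLeft, ← mul_kronecker_mul, pauliVec_mul_self hv, one_mul, one_kronecker_one]

theorem pauliRight_mul_self {v : EuclideanSpace ℝ (Fin 3)} (hv : ‖v‖ = 1) :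
    pauliRight v * pauliRight v = 1 := by
  rw [pauliRight, ← mul_kronecker_mul, pauliVec_mul_self hv, one_mul, one_kronecker_one]

theorem pauliLeft_mul_pauliRight (m n : EuclideanSpace ℝ (Fin 3)) :
    pauliLeft m * pauliRight n = pauliVec m ⊗ₖ pauliVec n := by
  rw [pauliLeft, pauliRight, ← mul_kronecker_mul, mul_one, one_mul]

theorem pauliLeft_commute_pauliRight (m n : EuclideanSpace ℝ (Fin 3)) :
    pauliLeft m * pauliRight n = pauliRight n * pauliLeft m := by
  rw [pauliLeft, pauliRight, ← mul_kronecker_mul, ← mul_kronecker_mul, mul_one, one_mul, mul_one,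
    one_mul]

theorem qubitGenerator_kronecker (m n : EuclideanSpace ℝ (Fin 3)) (t₁ t₂ : ℝ) :
    qubitGenerator m t₁ ⊗ₖ qubitGenerator n t₂ = ((t₁ * t₂ : ℝ) : ℂ) • 1 + (t₂ : ℂ) • pauliLeft m
      + (t₁ : ℂ) • pauliRight n + ((1 : ℝ) : ℂ) • (pauliLeft m * pauliRight n) := by
  rw [pauliLeft_mul_pauliRight, qubitGenerator_eq, qubitGenerator_eq, add_kronecker, kronecker_add,
    kronecker_add, smul_kronecker, smul_kronecker, kronecker_smul, kronecker_smul,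
    one_kronecker_one, pauliLeft, pauliRight]
  push_cast
  module

theorem isHermitian_kronecker (m n : EuclideanSpace ℝ (Fin 3)) (t₁ t₂ : ℝ) :
    (qubitGenerator m t₁ ⊗ₖ qubitGenerator n t₂).IsHermitian := by
  rw [Matrix.IsHermitian, conjTranspose_kronecker, (isHermitian_qubitGenerator m t₁).eq,
    (isHermitian_qubitGenerator n t₂).eq]

theorem pauliLeft_commute_generator (m n : EuclideanSpace ℝ (Fin 3)) (t₁ t₂ : ℝ) :
    pauliLeft m * (qubitGenerator m t₁ ⊗ₖ qubitGenerator n t₂)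
      = (qubitGenerator m t₁ ⊗ₖ qubitGenerator n t₂) * pauliLeft m := by
  rw [pauliLeft, ← mul_kronecker_mul, ← mul_kronecker_mul, mul_one, one_mul, qubitGenerator_eq,
    mul_add, add_mul, mul_smul_comm, smul_mul_assoc, mul_one, one_mul]

theorem pauliRight_commute_generator (m n : EuclideanSpace ℝ (Fin 3)) (t₁ t₂ : ℝ) :
    pauliRight n * (qubitGenerator m t₁ ⊗ₖ qubitGenerator n t₂)
      = (qubitGenerator m t₁ ⊗ₖ qubitGenerator n t₂) * pauliRight n := by
  rw [pauliRight, ← mul_kronecker_mul, ← mul_kronecker_mul, mul_one, one_mul,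
    qubitGenerator_eq n, mul_add, add_mul, mul_smul_comm, smul_mul_assoc, mul_one, one_mul]

theorem exists_joint_eigenvector {m n : EuclideanSpace ℝ (Fin 3)} (hm : ‖m‖ = 1) (hn : ‖n‖ = 1)
    {s r : ℝ} (hs : s * s = 1) (hr : r * r = 1) :
    ∃ φ : Fin 2 × Fin 2 → ℂ, star φ ⬝ᵥ φ = 1 ∧ pauliLeft m *ᵥ φ = (s : ℂ) • φ ∧
      pauliRight n *ᵥ φ = (r : ℂ) • φ := by
  obtain ⟨e, he, hes⟩ := exists_pauliVec_eigenvector hm hs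
  obtain ⟨f, hf, hfr⟩ := exists_pauliVec_eigenvector hn hr
  refine ⟨fun x => e x.1 * f x.2, ?_, ?_, ?_⟩
  · have : (star e ⬝ᵥ e) * (star f ⬝ᵥ f) = 1 := by rw [he, hf, one_mul]
    rw [← this]
    simp [dotProduct, Fintype.sum_prod_type]
    ring
  · ext ⟨i, j⟩
    have := congrFun hes i
    simp [mulVec, dotProduct] at this
    simp [mulVec, dotProduct, Fintype.sum_prod_type, pauliLeft, kroneckerMap_apply,
      Matrix.one_apply]
    linear_combination f j * this
  · ext ⟨i, j⟩
    have := congrFun hfr j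
    simp [mulVec, dotProduct] at this
    simp [mulVec, dotProduct, Fintype.sum_prod_type, pauliRight, kroneckerMap_apply,
      Matrix.one_apply]
    fin_cases i <;> simp <;> linear_combination e _ * this

theorem mulVec_generator_of_joint_eigenvector {m n : EuclideanSpace ℝ (Fin 3)}
    {φ : Fin 2 × Fin 2 → ℂ} {s r : ℝ} (hH : pauliLeft m *ᵥ φ = (s : ℂ) • φ)
    (hK : pauliRight n *ᵥ φ = (r : ℂ) • φ) (t₁ t₂ : ℝ) :
    (qubitGenerator m t₁ ⊗ₖ qubitGenerator n t₂) *ᵥ φ = (((t₁ + s) * (t₂ + r) : ℝ) : ℂ) • φ := by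
  rw [qubitGenerator_kronecker, add_mulVec, add_mulVec, add_mulVec, smul_mulVec, smul_mulVec,
    smul_mulVec, smul_mulVec, one_mulVec, ← mulVec_mulVec, hK, mulVec_smul, hH]
  push_cast
  module

end Generator

/-! ### Equal superpositions of two eigenvectors -/

section Superposition

/-- Two unit eigenvectors of a Hermitian `Y` with different eigenvalues are orthogonal, so that
`(φ + φ') / √2` is a probe; its expectation values average those of `φ` and `φ'` for each observable
with both as eigenvectors. -/
theorem exists_superposition {φ φ' : Fin 2 × Fin 2 → ℂ} (hφ : star φ ⬝ᵥ φ = 1)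
    (hφ' : star φ' ⬝ᵥ φ' = 1) {Y : Matrix (Fin 2 × Fin 2) (Fin 2 × Fin 2) ℂ}
    (hY : Y.IsHermitian) {p q : ℝ} (hp : Y *ᵥ φ = (p : ℂ) • φ) (hq : Y *ᵥ φ' = (q : ℂ) • φ')
    (hpq : p ≠ q) :
    ∃ ψ ∈ pureProbes,
      (∀ (X : Matrix (Fin 2 × Fin 2) (Fin 2 × Fin 2) ℂ) (μ ν : ℂ), X *ᵥ φ = μ • φ →
        X *ᵥ φ' = ν • φ' → expect (ψ : Fin 2 × Fin 2 → ℂ) X = (μ + ν) / 2) ∧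
      (∀ (X : Matrix (Fin 2 × Fin 2) (Fin 2 × Fin 2) ℂ) (μ : ℂ), X *ᵥ φ = μ • φ →
        X *ᵥ φ' = μ • φ' → X *ᵥ ψ = μ • (ψ : Fin 2 × Fin 2 → ℂ)) := by
  have hpq' : (q : ℂ) - p ≠ 0 := by
    rw [sub_ne_zero]
    exact_mod_cast hpq.symm
  have orth : star φ ⬝ᵥ φ' = 0 := by
    have h1 : star φ ⬝ᵥ Y *ᵥ φ' = q * (star φ ⬝ᵥ φ') := by rw [hq, dotProduct_smul, smul_eq_mul]
    have h2 : star φ ⬝ᵥ Y *ᵥ φ' = p * (star φ ⬝ᵥ φ') := by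
      rw [dotProduct_mulVec, ← hY.eq, ← star_mulVec, hp, star_smul, smul_dotProduct,
        Complex.star_def, Complex.conj_ofReal, smul_eq_mul]
    exact (mul_eq_zero.1 (show ((q : ℂ) - p) * (star φ ⬝ᵥ φ') = 0 by
      rw [sub_mul, ← h1, ← h2, sub_self])).resolve_left hpq'
  have orth' : star φ' ⬝ᵥ φ = 0 := by
    rw [star_dotProduct, orth, star_zero]
  have hc : (((√2)⁻¹ : ℝ) : ℂ) * (((√2)⁻¹ : ℝ) : ℂ) = 1 / 2 := by
    rw [← Complex.ofReal_mul, ← mul_inv, Real.mul_self_sqrt (by norm_num)]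
    norm_num
  have hE : ∀ (X : Matrix (Fin 2 × Fin 2) (Fin 2 × Fin 2) ℂ) (μ ν : ℂ), X *ᵥ φ = μ • φ →
      X *ᵥ φ' = ν • φ' → expect ((((√2)⁻¹ : ℝ) : ℂ) • (φ + φ')) X = (μ + ν) / 2 := by
    intro X μ ν h h'
    rw [expect_eq_dotProduct, mulVec_smul, mulVec_add, h, h', star_smul, smul_dotProduct,
      dotProduct_smul, Complex.star_def, Complex.conj_ofReal, smul_smul, hc, star_add,
      add_dotProduct, dotProduct_add, dotProduct_add]
    simp only [dotProduct_smul, hφ, hφ', orth, orth', smul_eq_mul]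
    ring
  refine ⟨WithLp.toLp 2 ((((√2)⁻¹ : ℝ) : ℂ) • (φ + φ')), ?_, hE, ?_⟩
  · rw [mem_pureProbes_iff, ← expect_one]
    refine (hE 1 1 1 ?_ ?_).trans ?_
    · rw [one_mulVec, one_smul]
    · rw [one_mulVec, one_smul]
    · norm_num
  · intro X μ h h'
    change X *ᵥ ((((√2)⁻¹ : ℝ) : ℂ) • (φ + φ')) = μ • ((((√2)⁻¹ : ℝ) : ℂ) • (φ + φ'))
    rw [mulVec_smul, mulVec_add, h, h', ← smul_add, smul_comm]

end Superposition

/-! ### Fisher information of both systems -/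

section Joint

theorem expect_im_eq_zero {n : Type*} [Fintype n] (w : n → ℂ) {X : Matrix n n ℂ}
    (hX : X.IsHermitian) : (expect w X).im = 0 := by
  have h : star (expect w X) = expect w X := by
    rw [expect_eq_dotProduct, ← star_dotProduct, star_mulVec, hX.eq, dotProduct_mulVec]
  exact Complex.conj_eq_iff_im.1 h

theorem trace_outputBF_mul (G₁ G₂ : Matrix (Fin 2) (Fin 2) ℂ)
    (ψ : EuclideanSpace ℂ (Fin 2 × Fin 2)) (α : ℝ)
    (X : Matrix (Fin 2 × Fin 2) (Fin 2 × Fin 2) ℂ) :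
    Matrix.trace (outputBF G₁ G₂ ψ α * X) = expect (outputVec G₁ G₂ ψ α) X := by
  rw [outputBF_eq_vecMulVec, expect_apply]

theorem isHermitian_outputBF (G₁ G₂ : Matrix (Fin 2) (Fin 2) ℂ)
    (ψ : EuclideanSpace ℂ (Fin 2 × Fin 2)) (α : ℝ) : (outputBF G₁ G₂ ψ α).IsHermitian := by
  rw [Matrix.IsHermitian, outputBF_eq_vecMulVec, conjTranspose_vecMulVec, star_star]

theorem trace_outputBF {G₁ G₂ : Matrix (Fin 2) (Fin 2) ℂ} (h₁ : G₁.IsHermitian)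
    (h₂ : G₂.IsHermitian) {ψ : EuclideanSpace ℂ (Fin 2 × Fin 2)} (hψ : ψ ∈ pureProbes) (α : ℝ) :
    Matrix.trace (outputBF G₁ G₂ ψ α) = 1 := by
  rw [← mul_one (outputBF G₁ G₂ ψ α), trace_outputBF_mul, expect_one,
    star_dotProduct_outputVec h₁ h₂ hψ]

/-- The joint output state has a symmetric logarithmic derivative, and its Fisher information is
four times the variance of the generator in the probe, at all parameter values. -/
theorem exists_isSLD_outputBF_and_qfi {G₁ G₂ : Matrix (Fin 2) (Fin 2) ℂ} (h₁ : G₁.IsHermitian)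
    (h₂ : G₂.IsHermitian) {ψ : EuclideanSpace ℂ (Fin 2 × Fin 2)} (hψ : ψ ∈ pureProbes) (α : ℝ) :
    (∃ L, IsSLD (outputBF G₁ G₂ ψ) α L) ∧ qfi (outputBF G₁ G₂ ψ) α
      = 4 * (expect (ψ : Fin 2 × Fin 2 → ℂ) ((G₁ ⊗ₖ G₂) * (G₁ ⊗ₖ G₂))
        - expect (ψ : Fin 2 × Fin 2 → ℂ) (G₁ ⊗ₖ G₂) ^ 2).re := by
  have hG : (G₁ ⊗ₖ G₂).IsHermitian := by
    rw [Matrix.IsHermitian, conjTranspose_kronecker, h₁.eq, h₂.eq]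
  have h := isSLD_and_qfi_of_pure (isHermitian_outputBF G₁ G₂ ψ α) (trace_outputBF h₁ h₂ hψ α)
    (by rw [outputBF_eq_vecMulVec]; exact vecMulVec_mul_mul_vecMulVec _) hG
    (hasDerivAt_outputBF h₁ h₂ ψ α)
  rw [trace_outputBF_mul, trace_outputBF_mul, expect_outputVec h₁ h₂ (mul_assoc _ _ _),
    expect_outputVec h₁ h₂ rfl] at h
  exact ⟨⟨_, h.1⟩, h.2⟩

theorem qfi_outputBF_le {m n : EuclideanSpace ℝ (Fin 3)} (hm : ‖m‖ = 1) (hn : ‖n‖ = 1)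
    {t₁ t₂ : ℝ} {ψ : EuclideanSpace ℂ (Fin 2 × Fin 2)} (hψ : ψ ∈ pureProbes) {c R : ℝ}
    (hR : ∀ s r : ℝ, s * s = 1 → r * r = 1 → ((t₁ + s) * (t₂ + r) - c) ^ 2 ≤ R) (α : ℝ) :
    qfi (outputBF (qubitGenerator m t₁) (qubitGenerator n t₂) ψ) α ≤ 4 * R := by
  rw [(exists_isSLD_outputBF_and_qfi (isHermitian_qubitGenerator m t₁)
    (isHermitian_qubitGenerator n t₂) hψ α).2]
  have hψ1 := (mem_pureProbes_iff ψ).1 hψ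
  have key := expect_sq_le_of_joint_eigenvalues hψ1 (isHermitian_pauliLeft m)
    (isHermitian_pauliRight n) (pauliLeft_mul_self hm) (pauliRight_mul_self hn)
    (pauliLeft_commute_pauliRight m n) (a := t₁ * t₂ - c) (b := t₂) (c := t₁) (d := 1) (R := R)
    (fun s r hs hr => le_of_eq_of_le (by ring) (hR s r hs hr))
  have e : ((t₁ * t₂ - c : ℝ) : ℂ) • (1 : Matrix (Fin 2 × Fin 2) (Fin 2 × Fin 2) ℂ)
      + (t₂ : ℂ) • pauliLeft m + (t₁ : ℂ) • pauliRight n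
      + ((1 : ℝ) : ℂ) • (pauliLeft m * pauliRight n)
      = qubitGenerator m t₁ ⊗ₖ qubitGenerator n t₂ - (c : ℂ) • 1 := by
    rw [qubitGenerator_kronecker]
    push_cast
    module
  have him := expect_im_eq_zero (ψ : Fin 2 × Fin 2 → ℂ) (isHermitian_kronecker m n t₁ t₂)
  rw [e] at key
  generalize qubitGenerator m t₁ ⊗ₖ qubitGenerator n t₂ = G at *
  have e2 : (G - (c : ℂ) • 1) * (G - (c : ℂ) • 1) = G * G - ((2 * c : ℝ) : ℂ) • G
      + ((c ^ 2 : ℝ) : ℂ) • 1 := by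
    simp only [sub_mul, mul_sub, smul_mul_assoc, mul_smul_comm, one_mul, mul_one]
    push_cast
    module
  rw [e2, map_add, map_sub, map_smul, map_smul, expect_one, hψ1, smul_eq_mul, smul_eq_mul, mul_one,
    Complex.add_re, Complex.sub_re, Complex.re_ofReal_mul, Complex.ofReal_re] at key
  rw [Complex.sub_re, pow_two, Complex.mul_re, him]
  -- the variance is at most the second moment about `c`
  nlinarith [sq_nonneg ((expect (ψ : Fin 2 × Fin 2 → ℂ) G).re - c)]

end Joint

/-! ### Fisher information of the first system -/

section Reduced

theorem isHermitian_outputB (G₁ G₂ : Matrix (Fin 2) (Fin 2) ℂ)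
    (ψ : EuclideanSpace ℂ (Fin 2 × Fin 2)) (α : ℝ) : (outputB G₁ G₂ ψ α).IsHermitian := by
  rw [Matrix.IsHermitian, outputB, partialTraceRight_conjTranspose,
    (isHermitian_outputBF G₁ G₂ ψ α).eq]

theorem trace_outputB_mul (G₁ G₂ : Matrix (Fin 2) (Fin 2) ℂ)
    (ψ : EuclideanSpace ℂ (Fin 2 × Fin 2)) (α : ℝ) (X : Matrix (Fin 2) (Fin 2) ℂ) :
    Matrix.trace (outputB G₁ G₂ ψ α * X)
      = expect (outputVec G₁ G₂ ψ α) (X ⊗ₖ (1 : Matrix (Fin 2) (Fin 2) ℂ)) := by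
  rw [outputB, trace_partialTraceRight_mul, trace_outputBF_mul]

theorem trace_outputB {G₁ G₂ : Matrix (Fin 2) (Fin 2) ℂ} (h₁ : G₁.IsHermitian)
    (h₂ : G₂.IsHermitian) {ψ : EuclideanSpace ℂ (Fin 2 × Fin 2)} (hψ : ψ ∈ pureProbes) (α : ℝ) :
    Matrix.trace (outputB G₁ G₂ ψ α) = 1 := by
  rw [outputB, trace_partialTraceRight, trace_outputBF h₁ h₂ hψ]

/-- The reduced state has a symmetric logarithmic derivative also where it is not of full rank. -/
theorem exists_isSLD_outputB {G₁ G₂ : Matrix (Fin 2) (Fin 2) ℂ} (h₁ : G₁.IsHermitian)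
    (h₂ : G₂.IsHermitian) {ψ : EuclideanSpace ℂ (Fin 2 × Fin 2)} (hψ : ψ ∈ pureProbes) (α : ℝ) :
    ∃ L, IsSLD (outputB G₁ G₂ ψ) α L := by
  have hG : (G₁ ⊗ₖ G₂).IsHermitian := by
    rw [Matrix.IsHermitian, conjTranspose_kronecker, h₁.eq, h₂.eq]
  have hderiv := hasDerivAt_outputB h₁ h₂ ψ α
  set ρ := outputB G₁ G₂ ψ α with hρ
  set w := outputVec G₁ G₂ ψ α with hw
  set v := (-Complex.I) • ((G₁ ⊗ₖ G₂) *ᵥ w) with hv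
  -- both the state and its derivative are expressed by coefficient matrices
  have eρ : ρ = Matrix.of (Function.curry w) * (Matrix.of (Function.curry w))ᴴ := by
    rw [hρ, outputB, outputBF_eq_vecMulVec, partialTraceRight_vecMulVec]
  have eD : partialTraceRight ((-Complex.I) • ((G₁ ⊗ₖ G₂) * outputBF G₁ G₂ ψ α
      - outputBF G₁ G₂ ψ α * (G₁ ⊗ₖ G₂)))
      = Matrix.of (Function.curry v) * (Matrix.of (Function.curry w))ᴴ
        + Matrix.of (Function.curry w) * (Matrix.of (Function.curry v))ᴴ := by
    have e : (-Complex.I) • ((G₁ ⊗ₖ G₂) * outputBF G₁ G₂ ψ α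
        - outputBF G₁ G₂ ψ α * (G₁ ⊗ₖ G₂))
        = vecMulVec v (star w) - vecMulVec w (-star v) := by
      rw [outputBF_eq_vecMulVec, mul_vecMulVec, vecMulVec_mul, ← hw, hv, star_smul, star_mulVec,
        hG.eq, smul_vecMulVec, smul_sub, ← vecMulVec_smul]
      simp
    rw [e, partialTraceRight_sub, partialTraceRight_vecMulVec, ← star_neg,
      partialTraceRight_vecMulVec, sub_eq_add_neg, ← mul_neg, ← conjTranspose_neg]
    congr 3
    ext i j
    simp [Function.curry]
  have trD : Matrix.trace (partialTraceRight ((-Complex.I) • ((G₁ ⊗ₖ G₂) * outputBF G₁ G₂ ψ α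
      - outputBF G₁ G₂ ψ α * (G₁ ⊗ₖ G₂)))) = 0 := by
    rw [trace_partialTraceRight, trace_smul, trace_sub, trace_mul_comm, sub_self, smul_zero]
  generalize partialTraceRight ((-Complex.I) • ((G₁ ⊗ₖ G₂) * outputBF G₁ G₂ ψ α
      - outputBF G₁ G₂ ψ α * (G₁ ⊗ₖ G₂))) = D at hderiv eD trD
  have hDh : Dᴴ = D := by
    rw [eD, conjTranspose_add, conjTranspose_mul, conjTranspose_mul, conjTranspose_conjTranspose,
      conjTranspose_conjTranspose, add_comm]
  have hρh : ρᴴ = ρ := isHermitian_outputB G₁ G₂ ψ α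
  have h0 : ρ.det = 0 → Matrix.trace (D * ρ) = 0 := by
    intro h
    have hM : (Matrix.of (Function.curry w)).det = 0 := by
      rw [eρ, det_mul, det_conjTranspose] at h
      rcases mul_eq_zero.1 h with h | h
      · exact h
      · exact star_eq_zero.1 h
    rw [eD] at trD ⊢
    rw [eρ]
    exact trace_mul_eq_zero_of_det_eq_zero hM (by rw [det_conjTranspose, hM, star_zero]) trD
  refine ⟨(2 : ℂ) • D + (Matrix.trace (D * ρ) / ρ.det) • (ρ - 1), ?_,
    fun i j => (hderiv i j).congr_deriv ?_⟩
  · have hq : star (Matrix.trace (D * ρ) / ρ.det) = Matrix.trace (D * ρ) / ρ.det := by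
      rw [star_div₀, ← trace_conjTranspose, ← det_conjTranspose, conjTranspose_mul, hDh, hρh,
        trace_mul_comm]
    rw [Matrix.IsHermitian, conjTranspose_add, conjTranspose_smul, conjTranspose_smul, hq, hDh,
      conjTranspose_sub, hρh, conjTranspose_one]
    simp
  · rw [← hρ, lyapunov_fin_two (trace_outputB h₁ h₂ hψ α) trD h0]
    simp

/-- The shift `t₁` of the first generator commutes with all measurements on the first system, so
that only the second moment of `(m · σ) ⊗ G₂` bounds the Fisher information. -/
theorem qfi_outputB_le {m n : EuclideanSpace ℝ (Fin 3)} (hm : ‖m‖ = 1) (hn : ‖n‖ = 1)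
    (t₁ t₂ : ℝ) {ψ : EuclideanSpace ℂ (Fin 2 × Fin 2)} (hψ : ψ ∈ pureProbes) (α : ℝ) :
    qfi (outputB (qubitGenerator m t₁) (qubitGenerator n t₂) ψ) α ≤ 4 * (1 + |t₂|) ^ 2 := by
  have h₁ := isHermitian_qubitGenerator m t₁
  have h₂ := isHermitian_qubitGenerator n t₂
  obtain ⟨L, hL⟩ := exists_isSLD_outputB h₁ h₂ hψ α
  rw [hL.qfi_eq, trace_outputB_mul]
  have hw := star_dotProduct_outputVec h₁ h₂ hψ α
  have hsld : (1 / 2 : ℂ) • (L * outputB (qubitGenerator m t₁) (qubitGenerator n t₂) ψ α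
      + outputB (qubitGenerator m t₁) (qubitGenerator n t₂) ψ α * L)
      = partialTraceRight ((-Complex.I) • ((qubitGenerator m t₁ ⊗ₖ qubitGenerator n t₂)
        * outputBF (qubitGenerator m t₁) (qubitGenerator n t₂) ψ α
        - outputBF (qubitGenerator m t₁) (qubitGenerator n t₂) ψ α
          * (qubitGenerator m t₁ ⊗ₖ qubitGenerator n t₂))) := by
    ext i j
    exact (hL.2 i j).unique (hasDerivAt_outputB h₁ h₂ ψ α i j)
  have htr := congrArg (fun M => Matrix.trace (M * L)) hsld
  simp only [trace_partialTraceRight_mul, smul_mul_assoc, trace_smul, add_mul, sub_mul,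
    trace_add, trace_sub] at htr
  rw [Matrix.mul_assoc L, trace_mul_comm L, mul_assoc, trace_outputB_mul, mul_assoc (_ ⊗ₖ _),
    trace_mul_comm (_ ⊗ₖ _), mul_assoc, mul_assoc, trace_outputBF_mul, trace_outputBF_mul,
    ← map_sub] at htr
  have hXX : (L ⊗ₖ (1 : Matrix (Fin 2) (Fin 2) ℂ)) * (L ⊗ₖ (1 : Matrix (Fin 2) (Fin 2) ℂ))
      = (L * L) ⊗ₖ (1 : Matrix (Fin 2) (Fin 2) ℂ) := by
    rw [← mul_kronecker_mul, one_mul]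
  have hX : (L ⊗ₖ (1 : Matrix (Fin 2) (Fin 2) ℂ)).IsHermitian := by
    rw [Matrix.IsHermitian, conjTranspose_kronecker, hL.1.eq, conjTranspose_one]
  have hC : ((t₁ : ℂ) • ((1 : Matrix (Fin 2) (Fin 2) ℂ) ⊗ₖ qubitGenerator n t₂)).IsHermitian := by
    rw [Matrix.IsHermitian, conjTranspose_smul, conjTranspose_kronecker, conjTranspose_one, h₂.eq,
      Complex.star_def, Complex.conj_ofReal]
  rw [← hXX]
  refine (expect_sq_le _ hX (isHermitian_kronecker m n t₁ t₂) hC ?_ ?_).trans ?_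
  · rw [mul_smul_comm, smul_mul_assoc, ← mul_kronecker_mul, ← mul_kronecker_mul, mul_one, one_mul,
      mul_one, one_mul]
  · rw [hXX]
    simp only [smul_eq_mul] at htr
    linear_combination htr
  · have e : qubitGenerator m t₁ ⊗ₖ qubitGenerator n t₂
        - (t₁ : ℂ) • ((1 : Matrix (Fin 2) (Fin 2) ℂ) ⊗ₖ qubitGenerator n t₂)
        = ((0 : ℝ) : ℂ) • 1 + (t₂ : ℂ) • pauliLeft m
          + ((0 : ℝ) : ℂ) • pauliRight n + ((1 : ℝ) : ℂ) • (pauliLeft m * pauliRight n) := by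
      rw [sub_eq_iff_eq_add, qubitGenerator_eq m, add_kronecker, smul_kronecker,
        qubitGenerator_eq, kronecker_add (pauliVec m), kronecker_smul, pauliLeft_mul_pauliRight,
        pauliLeft]
      push_cast
      module
    rw [e]
    refine mul_le_mul_of_nonneg_left (expect_sq_le_of_joint_eigenvalues hw
      (isHermitian_pauliLeft m) (isHermitian_pauliRight n) (pauliLeft_mul_self hm)
      (pauliRight_mul_self hn) (pauliLeft_commute_pauliRight m n) ?_) (by norm_num)
    intro s r hs hr
    have e2 : (0 + t₂ * s + 0 * r + 1 * (s * r)) ^ 2 = t₂ ^ 2 + 2 * (t₂ * r) + 1 := by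
      linear_combination (t₂ + r) ^ 2 * hs + hr
    have hr1 : |r| = 1 := by
      rcases mul_self_eq_one_iff.1 hr with h | h <;> simp [h]
    have h3 : t₂ * r ≤ |t₂| := by
      have := le_abs_self (t₂ * r)
      rwa [abs_mul, hr1, mul_one] at this
    rw [e2, add_sq, one_pow, sq_abs]
    linarith

/-- If the second system is in an eigenstate of `n · σ`, then the state of the first system is
pure. -/
theorem det_outputB_eq_zero {G₁ G₂ : Matrix (Fin 2) (Fin 2) ℂ}
    {ψ : EuclideanSpace ℂ (Fin 2 × Fin 2)} {α : ℝ} {n : EuclideanSpace ℝ (Fin 3)} {r : ℝ}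
    (hr : r * r = 1)
    (h : pauliRight n *ᵥ outputVec G₁ G₂ ψ α = (r : ℂ) • outputVec G₁ G₂ ψ α) :
    (outputB G₁ G₂ ψ α).det = 0 := by
  rw [outputB, outputBF_eq_vecMulVec, partialTraceRight_vecMulVec, det_mul]
  generalize outputVec G₁ G₂ ψ α = w at h
  have hM : Matrix.of (Function.curry w) * ((pauliVec n)ᵀ - (r : ℂ) • 1) = 0 := by
    ext i j
    have := congrFun h (i, j)
    simp [mulVec, dotProduct, Fintype.sum_prod_type, pauliRight, kroneckerMap_apply,
      Matrix.one_apply] at this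
    rw [mul_sub, mul_smul_comm, mul_one]
    fin_cases i <;> simp [mul_apply, Function.curry] at this ⊢ <;> linear_combination this
  rw [mul_eq_zero]
  left
  by_contra h0
  have hz : (pauliVec n)ᵀ - (r : ℂ) • 1 = 0 := by
    have hu : IsUnit (Matrix.of (Function.curry w)) :=
      (isUnit_iff_isUnit_det _).2 (isUnit_iff_ne_zero.2 h0)
    exact hu.mul_right_eq_zero.1 hM
  have := congrArg Matrix.trace hz
  rw [trace_sub, trace_transpose, trace_pauliVec, trace_smul, trace_one, trace_zero] at this
  have hr0 : r = 0 := by simpa using this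
  rw [hr0] at hr
  norm_num at hr

/-- A probe in which `n · σ` has the definite value `r` and `m · σ` has mean zero gives a rotating
pure state of the first system, with the generator `(t₂ + r) G₁`. -/
theorem qfi_outputB_eq {m n : EuclideanSpace ℝ (Fin 3)} (hm : ‖m‖ = 1)
    (t₁ t₂ : ℝ) {ψ : EuclideanSpace ℂ (Fin 2 × Fin 2)} (hψ : ψ ∈ pureProbes) {r : ℝ}
    (hr : r * r = 1) (hK : pauliRight n *ᵥ ψ = (r : ℂ) • (ψ : Fin 2 × Fin 2 → ℂ))
    (hH : expect (ψ : Fin 2 × Fin 2 → ℂ) (pauliLeft m) = 0) (α : ℝ) :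
    qfi (outputB (qubitGenerator m t₁) (qubitGenerator n t₂) ψ) α = 4 * (t₂ + r) ^ 2 := by
  have h₁ := isHermitian_qubitGenerator m t₁
  have h₂ := isHermitian_qubitGenerator n t₂
  have hKw := mulVec_outputVec (pauliRight_commute_generator m n t₁ t₂) hK α
  have hHw := expect_outputVec h₁ h₂ (pauliLeft_commute_generator m n t₁ t₂) ψ α
  rw [hH] at hHw
  have hA : (((t₂ + r : ℝ) : ℂ) • qubitGenerator m t₁).IsHermitian := by
    rw [Matrix.IsHermitian, conjTranspose_smul, h₁.eq, Complex.star_def, Complex.conj_ofReal]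
  have hA1 : ((((t₂ + r : ℝ) : ℂ) • qubitGenerator m t₁)
      ⊗ₖ (1 : Matrix (Fin 2) (Fin 2) ℂ)).IsHermitian := by
    rw [Matrix.IsHermitian, conjTranspose_kronecker, hA.eq, conjTranspose_one]
  have hAe : (((t₂ + r : ℝ) : ℂ) • qubitGenerator m t₁) ⊗ₖ (1 : Matrix (Fin 2) (Fin 2) ℂ)
      = ((t₂ + r : ℝ) : ℂ) • (pauliLeft m + (t₁ : ℂ) • 1) := by
    rw [smul_kronecker, qubitGenerator_eq, add_kronecker, smul_kronecker, one_kronecker_one,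
      pauliLeft]
  have hGw : (qubitGenerator m t₁ ⊗ₖ qubitGenerator n t₂)
        *ᵥ outputVec (qubitGenerator m t₁) (qubitGenerator n t₂) ψ α
      = ((((t₂ + r : ℝ) : ℂ) • qubitGenerator m t₁) ⊗ₖ (1 : Matrix (Fin 2) (Fin 2) ℂ))
        *ᵥ outputVec (qubitGenerator m t₁) (qubitGenerator n t₂) ψ α := by
    rw [hAe, qubitGenerator_kronecker, add_mulVec, add_mulVec, add_mulVec, smul_mulVec, smul_mulVec,
      smul_mulVec, smul_mulVec, one_mulVec, ← mulVec_mulVec, hKw, mulVec_smul, smul_mulVec,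
      add_mulVec, smul_mulVec, one_mulVec]
    push_cast
    module
  have hGR : (qubitGenerator m t₁ ⊗ₖ qubitGenerator n t₂)
        * outputBF (qubitGenerator m t₁) (qubitGenerator n t₂) ψ α
      = ((((t₂ + r : ℝ) : ℂ) • qubitGenerator m t₁) ⊗ₖ (1 : Matrix (Fin 2) (Fin 2) ℂ))
        * outputBF (qubitGenerator m t₁) (qubitGenerator n t₂) ψ α := by
    rw [outputBF_eq_vecMulVec, mul_vecMulVec, mul_vecMulVec, hGw]
  have hRG := congrArg Matrix.conjTranspose hGR
  rw [conjTranspose_mul, conjTranspose_mul, (isHermitian_outputBF _ _ ψ α).eq,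
    (isHermitian_kronecker m n t₁ t₂).eq, hA1.eq] at hRG
  have hderiv := hasDerivAt_outputB h₁ h₂ ψ α
  rw [hGR, hRG, partialTraceRight_smul, partialTraceRight_sub, partialTraceRight_kronecker_mul,
    partialTraceRight_mul_kronecker] at hderiv
  rw [(isSLD_and_qfi_of_pure (isHermitian_outputB _ _ ψ α) (trace_outputB h₁ h₂ hψ α)
    (mul_mul_self_of_det_eq_zero (det_outputB_eq_zero hr hKw)) hA hderiv).2, trace_outputB_mul,
    trace_outputB_mul, ← mul_one (1 : Matrix (Fin 2) (Fin 2) ℂ), mul_kronecker_mul, mul_one, hAe]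
  have e : (((t₂ + r : ℝ) : ℂ) • (pauliLeft m + (t₁ : ℂ) • 1)) *
      (((t₂ + r : ℝ) : ℂ) • (pauliLeft m + (t₁ : ℂ) • 1))
      = (((t₂ + r) ^ 2 * (1 + t₁ ^ 2) : ℝ) : ℂ) • 1
        + (((t₂ + r) ^ 2 * (2 * t₁) : ℝ) : ℂ) • pauliLeft m := by
    simp only [smul_mul_assoc, mul_smul_comm, add_mul, mul_add, one_mul, mul_one,
      pauliLeft_mul_self hm]
    push_cast
    module
  rw [e]
  simp only [map_add, map_smul, expect_one, star_dotProduct_outputVec h₁ h₂ hψ, hHw, smul_eq_mul,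
    mul_one, mul_zero, add_zero, zero_add]
  norm_cast
  ring

end Reduced

/-! ### The maxima -/

section Maxima

/-- Half the spread of the eigenvalues `(t₁ ± 1) (t₂ ± 1)` of `G₁ ⊗ G₂`. -/
noncomputable def halfSpread (t₁ t₂ : ℝ) : ℝ :=
  max |t₁| |t₂| + max 1 (min |t₁| |t₂|)

theorem halfSpread_pos (t₁ t₂ : ℝ) : 0 < halfSpread t₁ t₂ :=
  add_pos_of_nonneg_of_pos (le_max_of_le_left (abs_nonneg _)) (lt_max_of_lt_left one_pos)

theorem halfSpread_of_le_right {t₁ t₂ : ℝ} (h : |t₁| ≤ |t₂|) (h1 : |t₁| ≤ 1) :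
    halfSpread t₁ t₂ = |t₂| + 1 := by
  rw [halfSpread, max_eq_right h, min_eq_left h, max_eq_left h1]

theorem halfSpread_of_le_left {t₁ t₂ : ℝ} (h : |t₂| ≤ |t₁|) (h1 : |t₂| ≤ 1) :
    halfSpread t₁ t₂ = |t₁| + 1 := by
  rw [halfSpread, max_eq_left h, min_eq_right h, max_eq_left h1]

theorem halfSpread_of_one_le {t₁ t₂ : ℝ} (h₁ : 1 ≤ |t₁|) (h₂ : 1 ≤ |t₂|) :
    halfSpread t₁ t₂ = |t₁| + |t₂| := by
  rw [halfSpread, max_eq_right (le_min h₁ h₂), max_add_min]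

theorem exists_sign_mul_abs (t : ℝ) : ∃ u : ℝ, u * u = 1 ∧ t = u * |t| := by
  rcases le_total 0 t with h | h
  · exact ⟨1, by norm_num, by rw [abs_of_nonneg h, one_mul]⟩
  · exact ⟨-1, by norm_num, by rw [abs_of_nonpos h]; ring⟩

/-- Two of the eigenvalues `(t₁ ± 1) (t₂ ± 1)` are `2 * halfSpread t₁ t₂` apart, and the others lie
between them. One of the two is the product of `t₁` and `t₂`, each moved away from zero. -/
theorem exists_extremal_eigenvalues (t₁ t₂ : ℝ) :
    ∃ s r s' r' : ℝ, s * s = 1 ∧ r * r = 1 ∧ s' * s' = 1 ∧ r' * r' = 1 ∧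
      ((t₁ + s) * (t₂ + r) - (t₁ + s') * (t₂ + r')) ^ 2 = 4 * halfSpread t₁ t₂ ^ 2 ∧
      ∀ p q : ℝ, p * p = 1 → q * q = 1 →
        ((t₁ + p) * (t₂ + q) - ((t₁ + s) * (t₂ + r) + (t₁ + s') * (t₂ + r')) / 2) ^ 2
          ≤ halfSpread t₁ t₂ ^ 2 := by
  obtain ⟨u, hu, hu'⟩ := exists_sign_mul_abs t₁
  obtain ⟨v, hv, hv'⟩ := exists_sign_mul_abs t₂
  have ha := abs_nonneg t₁
  have hb := abs_nonneg t₂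
  -- the eigenvalue for the signs `p = u p'` and `q = v q'`, up to the common factor `u v`
  have red : ∀ {c d p q : ℝ}, c = u * v * d → p * p = 1 → q * q = 1 →
      (∀ p' q' : ℝ, p' = 1 ∨ p' = -1 → q' = 1 ∨ q' = -1 →
        |(|t₁| + p') * (|t₂| + q') - d| ≤ halfSpread t₁ t₂) →
      ((t₁ + p) * (t₂ + q) - c) ^ 2 ≤ halfSpread t₁ t₂ ^ 2 := by
    intro c d p q hc hp hq h
    have h1 := h (u * p) (v * q)
      (mul_self_eq_one_iff.1 (by linear_combination p * p * hu + hp))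
      (mul_self_eq_one_iff.1 (by linear_combination q * q * hv + hq))
    have e : (t₁ + p) * (t₂ + q) - c = u * v * ((|t₁| + u * p) * (|t₂| + v * q) - d) := by
      rw [hc]
      nth_rewrite 1 [hu', hv']
      linear_combination (-p) * (v * |t₂| + v * v * q) * hu - (u * |t₁| + p) * q * hv
    rw [e, mul_pow, mul_pow, pow_two u, pow_two v, hu, hv, one_mul, one_mul, ← sq_abs]
    exact pow_le_pow_left₀ (abs_nonneg _) h1 2
  have hu2 : u ^ 2 = 1 := by rw [pow_two, hu]
  have hv2 : v ^ 2 = 1 := by rw [pow_two, hv]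
  have sq_signs : ∀ {k : ℝ}, (u * v * k) ^ 2 = k ^ 2 := by
    intro k
    rw [mul_pow, mul_pow, hu2, hv2, one_mul, one_mul]
  have regions : |t₁| ≤ |t₂| ∧ |t₁| ≤ 1 ∨ |t₂| ≤ |t₁| ∧ |t₂| ≤ 1 ∨ 1 ≤ |t₁| ∧ 1 ≤ |t₂| := by
    rcases le_total |t₁| |t₂| with h | h
    · rcases le_total |t₁| 1 with h1 | h1
      · exact Or.inl ⟨h, h1⟩
      · exact Or.inr (Or.inr ⟨h1, h1.trans h⟩)
    · rcases le_total |t₂| 1 with h1 | h1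
      · exact Or.inr (Or.inl ⟨h, h1⟩)
      · exact Or.inr (Or.inr ⟨h1.trans h, h1⟩)
  rcases regions with ⟨h, h1⟩ | ⟨h, h1⟩ | ⟨h, h1⟩
  · refine ⟨u, v, -u, v, hu, hv, by linear_combination hu, hv, ?_, fun p q hp hq =>
      red (d := |t₁| * (|t₂| + 1)) ?_ hp hq ?_⟩
    · rw [halfSpread_of_le_right h h1, show (t₁ + u) * (t₂ + v) - (t₁ + -u) * (t₂ + v)
        = u * v * (2 * (|t₂| + 1)) by linear_combination 2 * u * hv', sq_signs]
      ring
    · linear_combination (t₂ + v) * hu' + u * |t₁| * hv'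
    · rw [halfSpread_of_le_right h h1]
      rintro p' q' (rfl | rfl) (rfl | rfl) <;> rw [abs_le] <;> constructor <;> linarith
  · refine ⟨u, v, u, -v, hu, hv, hu, by linear_combination hv, ?_, fun p q hp hq =>
      red (d := |t₂| * (|t₁| + 1)) ?_ hp hq ?_⟩
    · rw [halfSpread_of_le_left h h1, show (t₁ + u) * (t₂ + v) - (t₁ + u) * (t₂ + -v)
        = u * v * (2 * (|t₁| + 1)) by linear_combination 2 * v * hu', sq_signs]
      ring
    · linear_combination (t₁ + u) * hv' + v * |t₂| * hu'
    · rw [halfSpread_of_le_left h h1]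
      rintro p' q' (rfl | rfl) (rfl | rfl) <;> rw [abs_le] <;> constructor <;> linarith
  · refine ⟨u, v, -u, -v, hu, hv, by linear_combination hu, by linear_combination hv, ?_,
      fun p q hp hq => red (d := |t₁| * |t₂| + 1) ?_ hp hq ?_⟩
    · rw [halfSpread_of_one_le h h1, show (t₁ + u) * (t₂ + v) - (t₁ + -u) * (t₂ + -v)
        = u * v * (2 * (|t₁| + |t₂|)) by linear_combination 2 * v * hu' + 2 * u * hv', sq_signs]
      ring
    · linear_combination t₂ * hu' + u * |t₁| * hv'
    · rw [halfSpread_of_one_le h h1]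
      rintro p' q' (rfl | rfl) (rfl | rfl) <;> rw [abs_le] <;> constructor <;> linarith

variable {m n : EuclideanSpace ℝ (Fin 3)}

/-- An equal superposition of eigenvectors for the two extremal eigenvalues of the generator is
optimal for the joint output. -/
theorem exists_optimal_outputBF (hm : ‖m‖ = 1) (hn : ‖n‖ = 1) (t₁ t₂ : ℝ) :
    ∃ ψ ∈ pureProbes, ∀ α : ℝ,
      qfi (outputBF (qubitGenerator m t₁) (qubitGenerator n t₂) ψ) α = 4 * halfSpread t₁ t₂ ^ 2 ∧
      ∀ ψ' ∈ pureProbes, qfi (outputBF (qubitGenerator m t₁) (qubitGenerator n t₂) ψ') α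
        ≤ 4 * halfSpread t₁ t₂ ^ 2 := by
  obtain ⟨s, r, s', r', hs, hr, hs', hr', hV, hle⟩ := exists_extremal_eigenvalues t₁ t₂
  obtain ⟨φ, hφ, hH, hK⟩ := exists_joint_eigenvector hm hn hs hr
  obtain ⟨φ', hφ', hH', hK'⟩ := exists_joint_eigenvector hm hn hs' hr'
  have hG := mulVec_generator_of_joint_eigenvector hH hK t₁ t₂
  have hG' := mulVec_generator_of_joint_eigenvector hH' hK' t₁ t₂
  have hne : (t₁ + s) * (t₂ + r) ≠ (t₁ + s') * (t₂ + r') := by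
    intro h
    rw [h, sub_self] at hV
    nlinarith [halfSpread_pos t₁ t₂]
  obtain ⟨ψ, hψ, hE, -⟩ :=
    exists_superposition hφ hφ' (isHermitian_kronecker m n t₁ t₂) hG hG' hne
  refine ⟨ψ, hψ, fun α => ⟨?_, fun ψ' hψ' => qfi_outputBF_le hm hn hψ' hle α⟩⟩
  rw [(exists_isSLD_outputBF_and_qfi (isHermitian_qubitGenerator m t₁)
    (isHermitian_qubitGenerator n t₂) hψ α).2, hE _ _ _ hG hG',
    hE _ ((((t₁ + s) * (t₂ + r)) ^ 2 : ℝ) : ℂ) ((((t₁ + s') * (t₂ + r')) ^ 2 : ℝ) : ℂ), ← hV]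
  · norm_cast
    ring
  · rw [← mulVec_mulVec, hG, mulVec_smul, hG, smul_smul, ← Complex.ofReal_mul, pow_two]
  · rw [← mulVec_mulVec, hG', mulVec_smul, hG', smul_smul, ← Complex.ofReal_mul, pow_two]

/-- A product probe is optimal for the first output alone: `G₂` has its eigenvalue of largest
modulus in the second factor, and `m · σ` has mean zero in the first. -/
theorem exists_optimal_outputB (hm : ‖m‖ = 1) (hn : ‖n‖ = 1) (t₁ t₂ : ℝ) :
    ∃ ψ ∈ pureProbes, ∀ α : ℝ,
      qfi (outputB (qubitGenerator m t₁) (qubitGenerator n t₂) ψ) α = 4 * (1 + |t₂|) ^ 2 ∧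
      ∀ ψ' ∈ pureProbes, qfi (outputB (qubitGenerator m t₁) (qubitGenerator n t₂) ψ') α
        ≤ 4 * (1 + |t₂|) ^ 2 := by
  obtain ⟨r, hr, hr'⟩ := exists_sign_mul_abs t₂
  obtain ⟨φ, hφ, hH, hK⟩ := exists_joint_eigenvector hm hn (mul_one (1 : ℝ)) hr
  obtain ⟨φ', hφ', hH', hK'⟩ := exists_joint_eigenvector hm hn
    (show (-1 : ℝ) * -1 = 1 by norm_num) hr
  obtain ⟨ψ, hψ, hE, hev⟩ :=
    exists_superposition hφ hφ' (isHermitian_pauliLeft m) hH hH' (by norm_num)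
  refine ⟨ψ, hψ, fun α => ⟨?_, fun ψ' hψ' => qfi_outputB_le hm hn t₁ t₂ hψ' α⟩⟩
  rw [qfi_outputB_eq hm t₁ t₂ hψ hr (hev _ _ hK hK') (by rw [hE _ _ _ hH hH']; norm_num)]
  have e : (t₂ + r) ^ 2 = (r * (1 + |t₂|)) ^ 2 := by
    congr 1
    linear_combination hr'
  rw [e, mul_pow, pow_two r, hr, one_mul]

theorem isGreatest_qfi_outputB (hm : ‖m‖ = 1) (hn : ‖n‖ = 1) (t₁ t₂ α : ℝ) :
    IsGreatest ((fun ψ => qfi (outputB (qubitGenerator m t₁) (qubitGenerator n t₂) ψ) α) ''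
      pureProbes) (4 * (1 + |t₂|) ^ 2) := by
  obtain ⟨ψ, hψ, h⟩ := exists_optimal_outputB hm hn t₁ t₂
  refine ⟨⟨ψ, hψ, (h α).1⟩, ?_⟩
  rintro _ ⟨ψ', hψ', rfl⟩
  exact (h α).2 ψ' hψ'

theorem isGreatest_qfi_outputBF (hm : ‖m‖ = 1) (hn : ‖n‖ = 1) (t₁ t₂ α : ℝ) :
    IsGreatest ((fun ψ => qfi (outputBF (qubitGenerator m t₁) (qubitGenerator n t₂) ψ) α) ''
      pureProbes) (4 * halfSpread t₁ t₂ ^ 2) := by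
  obtain ⟨ψ, hψ, h⟩ := exists_optimal_outputBF hm hn t₁ t₂
  refine ⟨⟨ψ, hψ, (h α).1⟩, ?_⟩
  rintro _ ⟨ψ', hψ', rfl⟩
  exact (h α).2 ψ' hψ'

theorem maxQFIB_eq (hm : ‖m‖ = 1) (hn : ‖n‖ = 1) (t₁ t₂ α : ℝ) :
    maxQFIB (qubitGenerator m t₁) (qubitGenerator n t₂) α = 4 * (1 + |t₂|) ^ 2 :=
  (isGreatest_qfi_outputB hm hn t₁ t₂ α).csSup_eq

theorem maxQFIBF_eq (hm : ‖m‖ = 1) (hn : ‖n‖ = 1) (t₁ t₂ α : ℝ) :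
    maxQFIBF (qubitGenerator m t₁) (qubitGenerator n t₂) α = 4 * halfSpread t₁ t₂ ^ 2 :=
  (isGreatest_qfi_outputBF hm hn t₁ t₂ α).csSup_eq

/-- The two maxima, `4 (1 + |t₂|)²` for the first output and `4 halfSpread²` for both, agree exactly
in the claimed region. -/
theorem one_add_abs_sq_eq_halfSpread_sq_iff (t₁ t₂ : ℝ) :
    4 * (1 + |t₂|) ^ 2 = 4 * halfSpread t₁ t₂ ^ 2 ↔ |t₁| ≤ min 1 |t₂| := by
  have hb := abs_nonneg t₂
  rw [mul_right_inj' (by norm_num), sq_eq_sq₀ (by linarith) (halfSpread_pos t₁ t₂).le, le_min_iff]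
  constructor
  · intro h
    by_contra hcon
    rcases le_total |t₂| 1 with h1 | h1
    · have h2 : |t₂| < |t₁| := by
        by_contra! h3
        exact hcon ⟨h3.trans h1, h3⟩
      rw [halfSpread_of_le_left h2.le h1] at h
      linarith
    · have h2 : 1 < |t₁| := by
        by_contra! h3
        exact hcon ⟨h3, h3.trans h1⟩
      rw [halfSpread_of_one_le h2.le h1] at h
      linarith
  · rintro ⟨h1, h⟩
    rw [halfSpread_of_le_right h h1, add_comm]

end Maxima
end Bottleneck

open Bottleneck in
theorem theorem2 (m n : EuclideanSpace ℝ (Fin 3)) (hm : ‖m‖ = 1) (hn : ‖n‖ = 1) (t₁ t₂ : ℝ)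
    (G₁ G₂ : Matrix (Fin 2) (Fin 2) ℂ)
    (hG₁ : G₁ = qubitGenerator m t₁) (hG₂ : G₂ = qubitGenerator n t₂) :
    -- the quantum Fisher informations are well defined for all pure probes
    (∀ ψ ∈ pureProbes, ∀ α : ℝ,
      (∃ L, IsSLD (outputB G₁ G₂ ψ) α L) ∧ (∃ L, IsSLD (outputBF G₁ G₂ ψ) α L)) ∧
    -- the suprema over pure probes are maxima
    (∀ α : ℝ,
      IsGreatest ((fun ψ => qfi (outputB G₁ G₂ ψ) α) '' pureProbes) (maxQFIB G₁ G₂ α) ∧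
      IsGreatest ((fun ψ => qfi (outputBF G₁ G₂ ψ) α) '' pureProbes) (maxQFIBF G₁ G₂ α)) ∧
    -- they are attained by probes that do not depend on `α`
    (∃ ψ ∈ pureProbes, ∀ α : ℝ, qfi (outputB G₁ G₂ ψ) α = maxQFIB G₁ G₂ α) ∧
    (∃ ψ ∈ pureProbes, ∀ α : ℝ, qfi (outputBF G₁ G₂ ψ) α = maxQFIBF G₁ G₂ α) ∧
    -- the criterion for a zero gap, and the gap
    ∀ α : ℝ,
      (maxQFIB G₁ G₂ α = maxQFIBF G₁ G₂ α ↔ |t₁| ≤ min 1 |t₂|) ∧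
      (|t₁| ≤ |t₂| → |t₁| ≤ 1 → maxQFIBF G₁ G₂ α - maxQFIB G₁ G₂ α = 0) ∧
      (|t₂| ≤ |t₁| → |t₂| ≤ 1 → maxQFIBF G₁ G₂ α - maxQFIB G₁ G₂ α =
        4 * (|t₁| - |t₂|) * (2 + |t₁| + |t₂|)) ∧
      (1 < t₁ → 1 < |t₂| → maxQFIBF G₁ G₂ α - maxQFIB G₁ G₂ α =
        4 * (t₁ - 1) * (t₁ + 2 * |t₂| + 1)) ∧
      (t₁ < -1 → 1 < |t₂| → maxQFIBF G₁ G₂ α - maxQFIB G₁ G₂ α =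
        4 * (t₁ + 1) * (t₁ - 2 * |t₂| - 1)) := by
  subst hG₁ hG₂
  have hB := maxQFIB_eq hm hn t₁ t₂
  have hBF := maxQFIBF_eq hm hn t₁ t₂
  refine ⟨fun ψ hψ α => ⟨exists_isSLD_outputB (isHermitian_qubitGenerator m t₁)
    (isHermitian_qubitGenerator n t₂) hψ α, (exists_isSLD_outputBF_and_qfi
    (isHermitian_qubitGenerator m t₁) (isHermitian_qubitGenerator n t₂) hψ α).1⟩, fun α => ?_,
    ?_, ?_, fun α => ?_⟩
  · rw [hB, hBF]
    exact ⟨isGreatest_qfi_outputB hm hn t₁ t₂ α, isGreatest_qfi_outputBF hm hn t₁ t₂ α⟩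
  · obtain ⟨ψ, hψ, h⟩ := exists_optimal_outputB hm hn t₁ t₂
    exact ⟨ψ, hψ, fun α => (h α).1.trans (hB α).symm⟩
  · obtain ⟨ψ, hψ, h⟩ := exists_optimal_outputBF hm hn t₁ t₂
    exact ⟨ψ, hψ, fun α => (h α).1.trans (hBF α).symm⟩
  rw [hB, hBF]
  refine ⟨one_add_abs_sq_eq_halfSpread_sq_iff t₁ t₂, fun h h1 => ?_, fun h h1 => ?_,
    fun h h1 => ?_, fun h h1 => ?_⟩
  · rw [halfSpread_of_le_right h h1]
    ring
  · rw [halfSpread_of_le_left h h1]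
    ring
  · rw [halfSpread_of_one_le (h.le.trans (le_abs_self _)) h1.le, abs_of_pos (by linarith)]
    ring
  · rw [halfSpread_of_one_le (by rw [abs_of_neg (by linarith)]; linarith) h1.le,
      abs_of_neg (by linarith)]
    ring
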